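/- Let $j\in\{0,\tfrac12,1,\tfrac32,\dots\}$ and let $J_x,J_y,J_z$ be the spin-$j$ angular momentum operators on $\mathbb C^{2j+1}$, in the orthonormal Dicke basis $|j,m\rangle$ ($m=-j,\dots,j$), so that $J_z|j,m\rangle=m|j,m\rangle$ and $J_\pm|j,m\rangle=(J_x\pm iJ_y)|j,m\rangle=\sqrt{(j\mp m)(j\pm m+1)}\,|j,m\pm1\rangle$. For $v\in\mathbb R^3$ put $J_v=v_xJ_x+v_yJ_y+v_zJ_z$; a rotation operator is $R=e^{-i\theta J_w}$ with $\theta\in\mathbb R$ and $w$ a unit vector. For a density operator $\rho$ and a Hermitian $X$ let $$I(\rho,X)=\operatorname{tr}(\rho X^2)-\operatorname{tr}(\sqrt\rho X\sqrt\rho X),\quad J(\rho,X)=\tfrac12\operatorname{tr}\big(\{\sqrt\rho,X-\operatorname{tr}\rho X\}^2\big),\quad U(\rho,X)=\sqrt{I(\rho,X)J(\rho,X)}.$$ Define $$D_s=\sum_{n=-j}^{j}s^{2(j-n)}\frac{1-s^2}{1-s^{4j+2}}|j,n\rangle\langle j,n|\ \ (s\in\mathbb R,\ s^2\neq1),\qquad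 |\varphi_{m,\beta}\rangle=A_m\,e^{\beta J_z}e^{-i\pi J_y/2}|j,m\rangle\ \ (\beta\in\mathbb R),$$ with $A_m>0$ the normalization constant. (1) General directions. Let $n_1,n_2,n_3$ be an orthonormal basis of $\mathbb R^3$. There is a rotation operator $R$ with $RJ_xR^\dagger=J_{n_1}$, $RJ_yR^\dagger=J_{n_2}$ and $RJ_zR^\dagger=\pm J_{n_3}$. Every state $\rho$ satisfies $$U(\rho,J_{n_1})\,U(\rho,J_{n_2})\ \ge\ \tfrac14\,|\operatorname{tr}\rho J_{n_3}|^2 .\qquad(*)$$ The left-hand side of $(*)$ vanishes if and only if $\rho$ commutes with $J_{n_1}$ or with $J_{n_2}$, and then the right-hand side vanishes too, so that $(*)$ is the trivial equality $0=0$. Apart from this, equality in $(*)$ is characterized as follows. If equality holds in $(*)$ and its left-hand side is not $0$, then for some rotation operator $R$ with $RJ_zR^\dagger=\pm J_{n_3}$ and either $RJ_xR^\dagger=\pm J_{n_1}$, $RJ_yR^\dagger=\pm J_{n_2}$ or $RJ_xR^\dagger=\pm J_{n_2}$, $RJ_yR^\dagger=\pm J_{n_1}$ (the signs being independent of each other),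 one has $$\text{either}\quad \rho=R\,D_s\,R^\dagger\ \text{ for some } s\in\mathbb R,\ s^2\ne1,\qquad\text{or}\quad \rho=R|\varphi_{m,\beta}\rangle\langle\varphi_{m,\beta}|R^\dagger\ \text{ for some } \beta\in\mathbb R,\ m\in\{-j,\dots,j\}.$$ Conversely, every state of either form, with $R$ as described, attains equality in $(*)$. (2) Every rotation operator $R$ occurs: there is an orthonormal basis $n_1,n_2,n_3$ with $RJ_xR^\dagger=J_{n_1}$, $RJ_yR^\dagger=J_{n_2}$, $RJ_zR^\dagger=J_{n_3}$, for which all $RD_sR^\dagger$ ($s^2\neq 1$) and all $R|\varphi_{m,\beta}\rangle\langle\varphi_{m,\beta}|R^\dagger$ are states attaining equality in $(*)$. (3) The coordinate axes. If a state $\rho$ attains equality in $$U(\rho,J_x)\,U(\rho,J_y)\ge\tfrac14|\operatorname{tr}\rho J_z|^2\qquad(**)$$ and the left-hand side is not $0$, then $\rho=D_s$ for some $s\in\mathbb R$ with $s^2\neq1$, or $\rho=|j,-j\rangle\langle j,-j|$, or $\rho=|\psi\rangle\langle\psi|$ with $|\psi\rangle=e^{-i\theta J_z}|\varphi_{m,\beta}\rangle$,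 where $\theta\in\{0,\pi/2\}$, $\beta\in\mathbb R$ and $m\in\{-j,\dots,j\}$. Conversely, all these states attain equality in $(**)$. (4) Gibbs form and coherent states. For $s\ne0$, $s^2\neq1$ one has $D_s=e^{-\beta J_z}/\operatorname{tr}e^{-\beta J_z}$ with $\beta=2\ln|s|$. For every $\beta\in\mathbb R$ (including $\beta=0$, the limit $s^2\to1$) the operator $e^{-\beta J_z}/\operatorname{tr}e^{-\beta J_z}$ is a state attaining equality in $(**)$. Moreover $D_0=|j,j\rangle\langle j,j|$, and $R D_0R^\dagger=|j,-j\rangle\langle j,-j|$ for some rotation operator $R$. (5) Spin $\tfrac12$. For $j=\tfrac12$, if a state $\rho$ attains equality in $(**)$ and the left-hand side is not $0$, then either, in the ordered basis $|\tfrac12,-\tfrac12\rangle,|\tfrac12,\tfrac12\rangle$, $$\rho=\begin{pmatrix}\frac{(s-1)^2}{2(s^2+1)}&0\\0&\frac{(s+1)^2}{2(s^2+1)}\end{pmatrix}\quad\text{for some } s\in\mathbb R,$$ or $\rho=|\psi\rangle\langle\psi|$ with $|\psi\rangle=\varepsilon\sqrt{\tfrac{1+t}2}\,|\tfrac12,-\tfrac12\rangle+\sqrt{\tfrac{1-t}2}\,|\tfrac12,\tfrac12\rangle$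 for some $t\in[-1,1]$ and $\varepsilon\in\{1,-1,i,-i\}$. Conversely, all these states attain equality in $(**)$. -/

import Mathlib

open Matrix

namespace SpinMUS

noncomputable section

/-- Operators on the Hilbert space `ℂ^(2j+1)` of a spin-`j` system, where `N = 2j`. -/
abbrev Op (N : ℕ) : Type := Matrix (Fin (N + 1)) (Fin (N + 1)) ℂ

/-! ### Angular momentum operators in the Dicke basis -/

/-- The magnetic quantum number `m = i - j` of the `i`-th Dicke state, `i = 0, …, 2j`. -/
def mag (N : ℕ) (i : Fin (N + 1)) : ℝ := (i : ℝ) - (N : ℝ) / 2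

/-- The Dicke state `|j, i - j⟩`; so `dicke N 0 = |j,-j⟩` and `dicke N (Fin.last N) = |j,j⟩`. -/
def dicke (N : ℕ) (i : Fin (N + 1)) : Fin (N + 1) → ℂ := Pi.single i 1

/-- `|ψ⟩⟨ψ|`. -/
def ketbra {N : ℕ} (ψ : Fin (N + 1) → ℂ) : Op N := vecMulVec ψ (star ψ)

/-- The raising operator: `J₊ |j,m⟩ = √((j - m)(j + m + 1)) |j,m+1⟩`. -/
def Jplus (N : ℕ) : Op N := Matrix.of fun a b =>
  if (a : ℕ) = b + 1 then
    ((Real.sqrt (((N : ℝ) / 2 - mag N b) * ((N : ℝ) / 2 + mag N b + 1)) : ℝ) : ℂ)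
  else 0

/-- The lowering operator: `J₋ |j,m⟩ = √((j + m)(j - m + 1)) |j,m-1⟩`. -/
def Jminus (N : ℕ) : Op N := Matrix.of fun a b =>
  if (a : ℕ) + 1 = b then
    ((Real.sqrt (((N : ℝ) / 2 + mag N b) * ((N : ℝ) / 2 - mag N b + 1)) : ℝ) : ℂ)
  else 0

/-- `J_x = (J₊ + J₋) / 2`. -/
def Jx (N : ℕ) : Op N := (1 / 2 : ℂ) • (Jplus N + Jminus N)

/-- `J_y = (J₊ - J₋) / (2i)`. -/
def Jy (N : ℕ) : Op N := (1 / (2 * Complex.I) : ℂ) • (Jplus N - Jminus N)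

/-- `J_z |j,m⟩ = m |j,m⟩`. -/
def Jz (N : ℕ) : Op N := Matrix.diagonal fun i => ((mag N i : ℝ) : ℂ)

/-- The angular momentum `v · J = v_x J_x + v_y J_y + v_z J_z` along `v ∈ ℝ³`. -/
def J (N : ℕ) (v : EuclideanSpace ℝ (Fin 3)) : Op N :=
  ((v 0 : ℝ) : ℂ) • Jx N + ((v 1 : ℝ) : ℂ) • Jy N + ((v 2 : ℝ) : ℂ) • Jz N

/-- `R = exp(-iθ w·J)` for some angle `θ` and some unit vector `w`. -/
def IsRotation {N : ℕ} (R : Op N) : Prop :=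
  ∃ (θ : ℝ) (w : EuclideanSpace ℝ (Fin 3)), ‖w‖ = 1 ∧
    R = NormedSpace.exp ((-(Complex.I * (θ : ℂ))) • J N w)

/-! ### States and uncertainties -/

open scoped ComplexOrder in
/-- Density operators. -/
def IsState {N : ℕ} (ρ : Op N) : Prop := ρ.PosSemidef ∧ ρ.trace = 1

open scoped MatrixOrder ComplexOrder in
/-- The positive semidefinite square root `√ρ`. -/
def sqrtOp {N : ℕ} (ρ : Op N) : Op N := CFC.sqrt ρ

/-- The Wigner–Yanase skew information `I(ρ,X) = tr(ρ X²) - tr(√ρ X √ρ X)`. -/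
def skewInfo {N : ℕ} (ρ X : Op N) : ℝ :=
  ((ρ * (X * X)).trace - (sqrtOp ρ * X * sqrtOp ρ * X).trace).re

/-- The centred observable `X₀ = X - tr(ρ X)`. -/
def centred {N : ℕ} (ρ X : Op N) : Op N := X - (ρ * X).trace • (1 : Op N)

/-- `J(ρ,X) = ½ tr({√ρ, X₀}²)`, with `{A, B} = AB + BA`. -/
def antiInfo {N : ℕ} (ρ X : Op N) : ℝ :=
  (1 / 2) * (((sqrtOp ρ * centred ρ X + centred ρ X * sqrtOp ρ) ^ 2).trace).re

/-- The quantum uncertainty `U(ρ,X) = √(I(ρ,X) J(ρ,X))`. -/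
def U {N : ℕ} (ρ X : Op N) : ℝ := Real.sqrt (skewInfo ρ X * antiInfo ρ X)

/-- `ρ` attains equality in `U(ρ,X) U(ρ,Y) ≥ ¼ |tr(ρ Z)|²`. -/
def Saturates {N : ℕ} (ρ X Y Z : Op N) : Prop :=
  U ρ X * U ρ Y = 1 / 4 * ‖(ρ * Z).trace‖ ^ 2

/-! ### The two families -/

/-- `∑ₙ s^(2(j-n)) (1 - s²) / (1 - s^(4j+2)) |j,n⟩⟨j,n|`.
With `n = i - j` one has `2(j - n) = 2(N - i)` and `4j + 2 = 2N + 2`. -/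
def diagState (N : ℕ) (s : ℝ) : Op N :=
  ∑ i : Fin (N + 1),
    ((s ^ (2 * (N - (i : ℕ))) * ((1 - s ^ 2) / (1 - s ^ (2 * N + 2))) : ℝ) : ℂ) •
      ketbra (dicke N i)

/-- The Gibbs state `exp(-β J_z) / tr exp(-β J_z)`. -/
def gibbs (N : ℕ) (β : ℝ) : Op N :=
  (NormedSpace.exp ((-(β : ℂ)) • Jz N)).trace⁻¹ • NormedSpace.exp ((-(β : ℂ)) • Jz N)

/-- `exp(β J_z) exp(-iπ J_y / 2) |j,m⟩` with `m = i - j`, not normalized. -/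
def squeezedVec (N : ℕ) (β : ℝ) (i : Fin (N + 1)) : Fin (N + 1) → ℂ :=
  NormedSpace.exp ((β : ℂ) • Jz N) *ᵥ
    (NormedSpace.exp ((-(Complex.I * (Real.pi : ℂ) / 2)) • Jy N) *ᵥ dicke N i)

/-- The unit vector `A_m exp(β J_z) exp(-iπ J_y / 2) |j,m⟩`,
where `A_m > 0` is the normalization constant. -/
def squeezed (N : ℕ) (β : ℝ) (i : Fin (N + 1)) : Fin (N + 1) → ℂ :=
  (((Real.sqrt (star (squeezedVec N β i) ⬝ᵥ squeezedVec N β i).re)⁻¹ : ℝ) : ℂ) •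
    squeezedVec N β i

/-- `A = B` or `A = -B`. -/
def EqUpToSign {N : ℕ} (A B : Op N) : Prop := A = B ∨ A = -B

/-- The rotation `R` takes the `z`-axis to the line of `n 2`, and the pair of the `x`- and `y`-axes
to the pair of the lines of `n 0` and `n 1` (in either order). -/
def Aligned {N : ℕ} (R : Op N) (n : Fin 3 → EuclideanSpace ℝ (Fin 3)) : Prop :=
  EqUpToSign (R * Jz N * Rᴴ) (J N (n 2)) ∧
    ((EqUpToSign (R * Jx N * Rᴴ) (J N (n 0)) ∧ EqUpToSign (R * Jy N * Rᴴ) (J N (n 1))) ∨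
     (EqUpToSign (R * Jx N * Rᴴ) (J N (n 1)) ∧ EqUpToSign (R * Jy N * Rᴴ) (J N (n 0))))

/-- First class, for the axes `x, y, z`: the diagonal states and `|j,-j⟩⟨j,-j|`. -/
def DiagClass {N : ℕ} (ρ : Op N) : Prop :=
  (∃ s : ℝ, s ^ 2 ≠ 1 ∧ ρ = diagState N s) ∨ ρ = ketbra (dicke N 0)

/-- Second class, for the axes `x, y, z`: the squeezed states and their images under the rotation
by `π/2` about the `z`-axis. -/
def SqueezedClass {N : ℕ} (ρ : Op N) : Prop :=
  ∃ (θ β : ℝ) (i : Fin (N + 1)), (θ = 0 ∨ θ = Real.pi / 2) ∧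
    ρ = ketbra (NormedSpace.exp ((-(Complex.I * (θ : ℂ))) • Jz N) *ᵥ squeezed N β i)

/-- First class, for a frame `n`: the rotated diagonal states. -/
def RotDiagClass {N : ℕ} (n : Fin 3 → EuclideanSpace ℝ (Fin 3)) (ρ : Op N) : Prop :=
  ∃ (R : Op N) (s : ℝ), IsRotation R ∧ Aligned R n ∧ s ^ 2 ≠ 1 ∧ ρ = R * diagState N s * Rᴴ

/-- Second class, for a frame `n`: the rotated squeezed states. -/
def RotSqueezedClass {N : ℕ} (n : Fin 3 → EuclideanSpace ℝ (Fin 3)) (ρ : Op N) : Prop :=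
  ∃ (R : Op N) (β : ℝ) (i : Fin (N + 1)), IsRotation R ∧ Aligned R n ∧
    ρ = ketbra (R *ᵥ squeezed N β i)

/-- Spin 1/2, first class; the basis is ordered `|½,-½⟩, |½,½⟩`. -/
def HalfDiagClass (ρ : Op 1) : Prop :=
  ∃ s : ℝ, ρ = !![(((s - 1) ^ 2 / (2 * (s ^ 2 + 1)) : ℝ) : ℂ), 0;
                  0, (((s + 1) ^ 2 / (2 * (s ^ 2 + 1)) : ℝ) : ℂ)]

/-- Spin 1/2, second class: `ε √((1+t)/2) |½,-½⟩ + √((1-t)/2) |½,½⟩`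
with `ε ∈ {1, -1, i, -i}`. -/
def HalfPureClass (ρ : Op 1) : Prop :=
  ∃ (t : ℝ) (ε : ℂ), -1 ≤ t ∧ t ≤ 1 ∧ ε ^ 4 = 1 ∧
    ρ = ketbra (N := 1) ![ε * ((Real.sqrt ((1 + t) / 2) : ℝ) : ℂ),
      ((Real.sqrt ((1 - t) / 2) : ℝ) : ℂ)]

end

end SpinMUS

namespace SpinMUS

/-! ### The square root of a density operator -/

section Sqrt

open scoped MatrixOrder ComplexOrder Matrix.Norms.L2Operator

variable {N : ℕ}

/-! Write `B = √ρ` and let `X₀`, `Y₀` be the centred observables. Then `I(ρ,X)` and `J(ρ,X)` are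
half the squared Hilbert–Schmidt norms of the Hermitian matrices `-i[B,X]` and `{B,X₀}`, and the
inner product of `-i[B,X]` with `{B,Y₀}` is `tr ρZ` when `[X,Y] = iZ`. Cauchy–Schwarz, used once for
`(X,Y)` and once for `(Y,X)`, gives the inequality after multiplication. Equality with a nonzero
left side forces both applications to be sharp: `[B,X₀] = ia{B,Y₀}` and `[B,Y₀] = ib{B,X₀}` with
real nonzero `a`, `b`.

These equations split into two cases (`Setting.exists_structure`). If `ab ≠ -1`, moving `B` past
`X₀` and `Y₀` acts on their span by a matrix of determinant one, so `B` commutes with `[X₀,Y₀]`,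
hence with `Z`. For the coordinate axes `B` is then diagonal, and the first equation makes its
entries a geometric progression (`diagClass_of_commute`). If `ab = -1`, every column of `B` lies in
a single eigenspace of `X + iaY`. For the axes and `|a| < 1`, `a = tanh β`, a multiple of this
operator is similar to `J_z` through the squeezing operator (`squeezer_mul_Jz`); for `|a| > 1` a
quarter turn about `z` reduces to that case; for `|a| = 1` it is a ladder operator. All these
eigenspaces are at most one-dimensional, so `ρ` is pure and known.

Other frames reduce to the axes by unitary conjugation. Euler's theorem (`exists_rot`) and the
action of exponentials on `J_v` (`exp_mul_ang`) supply the rotation, and Schur's lemma replaces a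
product of rotation operators by a single exponential with the same conjugation action
(`conj_eq_conj`). -/

theorem sqrtOp_posSemidef (ρ : Op N) : (sqrtOp ρ).PosSemidef :=
  nonneg_iff_posSemidef.1 (CFC.sqrt_nonneg ρ)

theorem sqrtOp_isHermitian (ρ : Op N) : (sqrtOp ρ).IsHermitian := (sqrtOp_posSemidef ρ).isHermitian

theorem sqrtOp_mul_self {ρ : Op N} (h : ρ.PosSemidef) : sqrtOp ρ * sqrtOp ρ = ρ :=
  CFC.sqrt_mul_sqrt_self ρ (nonneg_iff_posSemidef.2 h)

theorem sqrtOp_eq {ρ B : Op N} (hB : B.PosSemidef) (h : B * B = ρ) : sqrtOp ρ = B :=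
  CFC.sqrt_unique h (nonneg_iff_posSemidef.2 hB)

theorem commute_sqrtOp {ρ X : Op N} (h : Commute ρ X) : Commute (sqrtOp ρ) X :=
  h.cfcₙ_nnreal _

theorem sqrtOp_conj {V ρ : Op N} (hV : Vᴴ * V = 1) (h : ρ.PosSemidef) :
    sqrtOp (V * ρ * Vᴴ) = V * sqrtOp ρ * Vᴴ := by
  refine sqrtOp_eq ((sqrtOp_posSemidef ρ).mul_mul_conjTranspose_same V) ?_
  calc V * sqrtOp ρ * Vᴴ * (V * sqrtOp ρ * Vᴴ) = V * sqrtOp ρ * (Vᴴ * V) * sqrtOp ρ * Vᴴ := by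
        noncomm_ring
    _ = V * (sqrtOp ρ * sqrtOp ρ) * Vᴴ := by rw [hV]; noncomm_ring
    _ = V * ρ * Vᴴ := by rw [sqrtOp_mul_self h]

end Sqrt

/-! ### The trace form on Hermitian matrices -/

section TraceForm

open Complex
variable {N : ℕ}

/-- The real trace form `Re tr (C D)`. -/
noncomputable def traceForm (C D : Op N) : ℝ := (C * D).trace.re

theorem trace_mul_eq_traceForm {C D : Op N} (hC : C.IsHermitian) (hD : D.IsHermitian) :
    (C * D).trace = (traceForm C D : ℂ) := by
  have h : star (C * D).trace = (C * D).trace := by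
    rw [← trace_conjTranspose, conjTranspose_mul, hC.eq, hD.eq, trace_mul_comm]
  exact (conj_eq_iff_re.1 h).symm

theorem traceForm_self_nonneg {C : Op N} (hC : C.IsHermitian) : 0 ≤ traceForm C C := by
  open scoped ComplexOrder in
  have h := (posSemidef_self_mul_conjTranspose C).trace_nonneg
  rw [hC.eq] at h
  exact (Complex.le_def.1 h).1

theorem traceForm_self_eq_zero {C : Op N} (hC : C.IsHermitian) : traceForm C C = 0 ↔ C = 0 := by
  open scoped ComplexOrder in
  constructor
  · intro h
    have h' := trace_mul_eq_traceForm hC hC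
    rw [h, ofReal_zero] at h'
    nth_rewrite 2 [← hC.eq] at h'
    exact trace_mul_conjTranspose_self_eq_zero_iff.1 h'
  · rintro rfl
    simp [traceForm]

theorem traceForm_sub_smul (C D : Op N) (a : ℝ) :
    traceForm (C - (a : ℂ) • D) (C - (a : ℂ) • D) =
      traceForm C C - 2 * a * traceForm C D + a ^ 2 * traceForm D D := by
  have h := trace_mul_comm D C
  simp only [traceForm, sub_mul, mul_sub, smul_mul_assoc, mul_smul_comm, trace_sub, trace_smul,
    smul_eq_mul, sub_re, re_ofReal_mul, h]
  ring

theorem isHermitian_sub_smul {C D : Op N} (hC : C.IsHermitian) (hD : D.IsHermitian) (a : ℝ) :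
    (C - (a : ℂ) • D).IsHermitian := by
  simp [IsHermitian, conjTranspose_sub, conjTranspose_smul, hC.eq, hD.eq]

theorem traceForm_sq_le {C D : Op N} (hC : C.IsHermitian) (hD : D.IsHermitian) :
    traceForm C D ^ 2 ≤ traceForm C C * traceForm D D := by
  rcases (traceForm_self_nonneg hD).eq_or_lt' with h0 | hpos
  · rw [(traceForm_self_eq_zero hD).1 h0]
    simp [traceForm]
  · have h := traceForm_self_nonneg
      (isHermitian_sub_smul hC hD (traceForm C D / traceForm D D))
    rw [traceForm_sub_smul] at h
    have e : traceForm C C - 2 * (traceForm C D / traceForm D D) * traceForm C D +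
        (traceForm C D / traceForm D D) ^ 2 * traceForm D D =
        (traceForm C C * traceForm D D - traceForm C D ^ 2) / traceForm D D := by
      field_simp; ring
    rw [e] at h
    have := (le_div_iff₀ hpos).1 h
    linarith

/-- Equality in Cauchy–Schwarz makes the component of `C` orthogonal to `D` have norm zero. The
factor is real because the form is real on Hermitian matrices. -/
theorem eq_smul_of_traceForm_sq_eq {C D : Op N} (hC : C.IsHermitian) (hD : D.IsHermitian)
    (hD0 : D ≠ 0) (h : traceForm C D ^ 2 = traceForm C C * traceForm D D) :
    ∃ a : ℝ, C = (a : ℂ) • D := by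
  have hne : traceForm D D ≠ 0 := fun h => hD0 ((traceForm_self_eq_zero hD).1 h)
  refine ⟨traceForm C D / traceForm D D, sub_eq_zero.1 ((traceForm_self_eq_zero
    (isHermitian_sub_smul hC hD _)).1 ?_)⟩
  rw [traceForm_sub_smul]
  field_simp
  linarith

end TraceForm

/-! ### Uncertainties as squared norms -/

section Uncertainty

open Complex
open scoped ComplexOrder
variable {N : ℕ}

/-- `-i [B, X]`. -/
noncomputable def skewPart (B X : Op N) : Op N := (-I) • (B * X - X * B)

/-- `{B, X}`. -/
def antiPart (B X : Op N) : Op N := B * X + X * B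

theorem skewPart_isHermitian {B X : Op N} (hB : B.IsHermitian) (hX : X.IsHermitian) :
    (skewPart B X).IsHermitian := by
  simp [IsHermitian, skewPart, conjTranspose_smul, hB.eq, hX.eq, smul_sub, neg_add_eq_sub]

theorem antiPart_isHermitian {B X : Op N} (hB : B.IsHermitian) (hX : X.IsHermitian) :
    (antiPart B X).IsHermitian := by
  simp [IsHermitian, antiPart, conjTranspose_add, hB.eq, hX.eq, add_comm]

theorem centred_isHermitian {ρ X : Op N} (hρ : ρ.IsHermitian) (hX : X.IsHermitian) :
    (centred ρ X).IsHermitian := by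
  rw [centred, trace_mul_eq_traceForm hρ hX]
  exact isHermitian_sub_smul hX (isHermitian_one) _

theorem skewPart_eq_zero {B X : Op N} : skewPart B X = 0 ↔ Commute B X := by
  simp [skewPart, sub_eq_zero, Commute, SemiconjBy]

theorem skewPart_centred (ρ B X : Op N) : skewPart B (centred ρ X) = skewPart B X := by
  simp [skewPart, centred, mul_sub, sub_mul]

/-- Expand the square of the commutator: by cyclicity of the trace the four terms coincide in pairs.
-/
theorem skewInfo_eq {ρ : Op N} (hρ : ρ.PosSemidef) (X : Op N) :
    skewInfo ρ X = traceForm (skewPart (sqrtOp ρ) X) (skewPart (sqrtOp ρ) X) / 2 := by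
  have h1 := sqrtOp_mul_self hρ
  set B := sqrtOp ρ with hB
  have e1 : (B * X * X * B).trace = (B * B * X * X).trace := by
    rw [trace_mul_comm]; simp only [mul_assoc]
  have e2 : (X * B * B * X).trace = (B * B * X * X).trace := by
    rw [mul_assoc, mul_assoc, trace_mul_comm]; simp only [mul_assoc]
  have e3 : (X * B * X * B).trace = (B * X * B * X).trace := by
    rw [mul_assoc, mul_assoc, trace_mul_comm]; simp only [mul_assoc]
  have e : (skewPart B X * skewPart B X).trace =
      2 * ((B * B * (X * X)).trace - (B * X * B * X).trace) := by
    have : skewPart B X * skewPart B X =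
        -(B * X * B * X + X * B * X * B - B * X * X * B - X * B * B * X) := by
      simp only [skewPart, smul_mul_smul_comm]
      rw [show -I * -I = -1 by simp, neg_one_smul]
      noncomm_ring
    rw [this]
    simp only [trace_neg, trace_sub, trace_add, e1, e2, e3, ← mul_assoc]
    ring
  rw [traceForm, e, skewInfo, ← hB, h1]
  simp

theorem antiInfo_eq (ρ X : Op N) :
    antiInfo ρ X = traceForm (antiPart (sqrtOp ρ) (centred ρ X))
      (antiPart (sqrtOp ρ) (centred ρ X)) / 2 := by
  rw [antiInfo, traceForm, antiPart, sq]
  ring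

/-- The two terms of type `BXBY` cancel by cyclicity, and the other two combine to the commutator.
This is the pairing fed into Cauchy–Schwarz. -/
theorem trace_commutator (B X Y : Op N) :
    (skewPart B X * antiPart B Y).trace = -I * (B * B * (X * Y - Y * X)).trace := by
  have e1 : (X * B * Y * B).trace = (B * X * B * Y).trace := by
    rw [trace_mul_comm]; simp only [mul_assoc]
  have e2 : (B * X * Y * B).trace = (B * B * X * Y).trace := by
    rw [trace_mul_comm]; simp only [mul_assoc]
  have e3 : (X * B * B * Y).trace = (B * B * Y * X).trace := by
    rw [mul_assoc, mul_assoc, trace_mul_comm]; simp only [mul_assoc]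
  have : skewPart B X * antiPart B Y =
      (-I) • (B * X * B * Y + B * X * Y * B - X * B * B * Y - X * B * Y * B) := by
    simp only [skewPart, antiPart, smul_mul_assoc]
    congr 1
    noncomm_ring
  rw [this]
  simp only [trace_smul, trace_sub, trace_add, e1, e2, e3, mul_sub, smul_eq_mul, ← mul_assoc]
  ring

/-- The data of an uncertainty relation: a state and Hermitian `X, Y, Z` with `[X, Y] = iZ`. -/
structure Setting (ρ X Y Z : Op N) : Prop where
  state : IsState ρ
  hX : X.IsHermitian
  hY : Y.IsHermitian
  comm : X * Y - Y * X = I • Z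

variable {ρ X Y Z : Op N}

theorem Setting.swap (h : Setting ρ X Y Z) : Setting ρ Y X (-Z) :=
  ⟨h.state, h.hY, h.hX, by rw [← neg_sub, h.comm, smul_neg]⟩

theorem Setting.trace_eq (h : Setting ρ X Y Z) :
    (ρ * Z).trace =
      (traceForm (skewPart (sqrtOp ρ) X) (antiPart (sqrtOp ρ) (centred ρ Y)) : ℂ) := by
  have hB := sqrtOp_isHermitian ρ
  have hρ := h.state.1.isHermitian
  rw [← trace_mul_eq_traceForm (skewPart_isHermitian hB h.hX)
    (antiPart_isHermitian hB (centred_isHermitian hρ h.hY)), trace_commutator,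
    sqrtOp_mul_self h.state.1]
  have : X * centred ρ Y - centred ρ Y * X = I • Z := by
    rw [← h.comm]; simp [centred, mul_sub, sub_mul]
  rw [this, mul_smul_comm, trace_smul, smul_eq_mul, ← mul_assoc]
  simp

theorem Setting.skewInfo_nonneg (h : Setting ρ X Y Z) : 0 ≤ skewInfo ρ X := by
  rw [skewInfo_eq h.state.1]
  exact div_nonneg (traceForm_self_nonneg (skewPart_isHermitian (sqrtOp_isHermitian ρ) h.hX))
    zero_le_two

theorem Setting.antiInfo_nonneg (h : Setting ρ X Y Z) : 0 ≤ antiInfo ρ X := by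
  rw [antiInfo_eq]
  exact div_nonneg (traceForm_self_nonneg (antiPart_isHermitian (sqrtOp_isHermitian ρ)
    (centred_isHermitian h.state.1.isHermitian h.hX))) zero_le_two

theorem Setting.sq_le (h : Setting ρ X Y Z) :
    ‖(ρ * Z).trace‖ ^ 2 ≤ 4 * (skewInfo ρ X * antiInfo ρ Y) := by
  have hB := sqrtOp_isHermitian ρ
  rw [h.trace_eq, norm_real, Real.norm_eq_abs, sq_abs, skewInfo_eq h.state.1, antiInfo_eq]
  have := traceForm_sq_le (skewPart_isHermitian hB h.hX)
    (antiPart_isHermitian hB (centred_isHermitian h.state.1.isHermitian h.hY))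
  linarith

theorem Setting.sq_le' (h : Setting ρ X Y Z) :
    ‖(ρ * Z).trace‖ ^ 2 ≤ 4 * (skewInfo ρ Y * antiInfo ρ X) := by
  have := h.swap.sq_le
  simpa using this

/-- The four factors are regrouped crosswise because Cauchy–Schwarz bounds the skew part of one
observable times the anticommutator part of the other. -/
theorem Setting.U_mul_U (h : Setting ρ X Y Z) :
    U ρ X * U ρ Y =
      Real.sqrt ((skewInfo ρ X * antiInfo ρ Y) * (skewInfo ρ Y * antiInfo ρ X)) := by
  rw [U, U, ← Real.sqrt_mul (mul_nonneg h.skewInfo_nonneg h.antiInfo_nonneg)]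
  congr 1; ring

theorem Setting.le_U_mul_U (h : Setting ρ X Y Z) :
    1 / 4 * ‖(ρ * Z).trace‖ ^ 2 ≤ U ρ X * U ρ Y := by
  rw [h.U_mul_U]
  apply Real.le_sqrt_of_sq_le
  have h1 := h.sq_le
  have h2 := h.sq_le'
  have := mul_le_mul h1 h2 (sq_nonneg _) ((sq_nonneg _).trans h1)
  linarith

theorem Setting.trace_eq_zero (h : Setting ρ X Y Z) (h0 : U ρ X * U ρ Y = 0) :
    (ρ * Z).trace = 0 := by
  have := h.le_U_mul_U
  rw [h0] at this
  have h1 : ‖(ρ * Z).trace‖ ^ 2 = 0 := le_antisymm (by linarith) (sq_nonneg _)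
  simpa using h1

theorem Setting.U_eq_zero_iff (h : Setting ρ X Y Z) : U ρ X = 0 ↔ Commute ρ X := by
  have hB := sqrtOp_isHermitian ρ
  have hs := sqrtOp_mul_self h.state.1
  rw [U, Real.sqrt_eq_zero (mul_nonneg h.skewInfo_nonneg h.antiInfo_nonneg), mul_eq_zero,
    skewInfo_eq h.state.1, antiInfo_eq, div_eq_zero_iff, div_eq_zero_iff,
    traceForm_self_eq_zero (skewPart_isHermitian hB h.hX), traceForm_self_eq_zero
      (antiPart_isHermitian hB (centred_isHermitian h.state.1.isHermitian h.hX)), skewPart_eq_zero]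
  simp only [OfNat.ofNat_ne_zero, or_false]
  constructor
  · rintro (h1 | h1)
    · rw [← hs]; exact h1.mul_left h1
    -- An operator anticommuting with `√ρ` commutes with its square `ρ`.
    · have h2 : sqrtOp ρ * centred ρ X = -(centred ρ X * sqrtOp ρ) := eq_neg_of_add_eq_zero_left h1
      have h3 : Commute ρ (centred ρ X) := by
        have h4 : Commute (sqrtOp ρ * sqrtOp ρ) (centred ρ X) := by
          rw [Commute, SemiconjBy, mul_assoc, h2, mul_neg, ← mul_assoc, h2, neg_mul, neg_neg,
            mul_assoc]
        rwa [hs] at h4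
      have h4 : X = centred ρ X + (ρ * X).trace • (1 : Op N) := by simp [centred]
      rw [h4]
      exact h3.add_right ((Commute.one_right ρ).smul_right _)
  · exact fun h1 => Or.inl (commute_sqrtOp h1)

theorem Setting.saturates_of_commute (h : Setting ρ X Y Z) (hc : Commute ρ X ∨ Commute ρ Y) :
    Saturates ρ X Y Z := by
  have h0 : U ρ X * U ρ Y = 0 := by
    rcases hc with hc | hc
    · rw [h.U_eq_zero_iff.2 hc, zero_mul]
    · rw [h.swap.U_eq_zero_iff.2 hc, mul_zero]
  rw [Saturates, h0, h.trace_eq_zero h0]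
  simp

theorem Setting.saturates_of_eq_smul (h : Setting ρ X Y Z) {a b : ℝ}
    (h1 : skewPart (sqrtOp ρ) X = (a : ℂ) • antiPart (sqrtOp ρ) (centred ρ Y))
    (h2 : skewPart (sqrtOp ρ) Y = (b : ℂ) • antiPart (sqrtOp ρ) (centred ρ X)) :
    Saturates ρ X Y Z := by
  have smul_l : ∀ (c : ℝ) (C D : Op N), traceForm ((c : ℂ) • C) D = c * traceForm C D := by
    intro c C D; simp [traceForm]
  have smul_r : ∀ (c : ℝ) (C D : Op N), traceForm C ((c : ℂ) • D) = c * traceForm C D := by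
    intro c C D; simp [traceForm]
  have t1 := h.trace_eq
  have t2 := h.swap.trace_eq
  have iX := skewInfo_eq h.state.1 X
  have iY := skewInfo_eq h.state.1 Y
  have jX := antiInfo_eq ρ X
  have jY := antiInfo_eq ρ Y
  rw [mul_neg, trace_neg] at t2
  rw [h1, smul_l] at t1 iX
  rw [h2, smul_l] at t2 iY
  rw [smul_r] at iX iY
  rw [Saturates, h.U_mul_U, t1, norm_real, Real.norm_eq_abs, sq_abs]
  rw [t1] at t2
  have t3 := congrArg Complex.re t2
  rw [neg_re, ofReal_re, ofReal_re] at t3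
  rw [iX, iY, jX, jY]
  set p := traceForm (antiPart (sqrtOp ρ) (centred ρ X)) (antiPart (sqrtOp ρ) (centred ρ X))
  set q := traceForm (antiPart (sqrtOp ρ) (centred ρ Y)) (antiPart (sqrtOp ρ) (centred ρ Y))
  -- Both proportionalities compute the same trace, `aq = -bp`, so the product under the root is a
  -- perfect square.
  have e : a * (a * q) / 2 * (q / 2) * (b * (b * p) / 2 * (p / 2)) = (1 / 4 * (a * q) ^ 2) ^ 2 := by
    have e' : b * (b * p) / 2 * (p / 2) = (b * p) ^ 2 / 4 := by ring
    rw [e', ← t3]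
    ring
  rw [e, Real.sqrt_sq (by positivity)]

theorem Setting.exists_eq_smul (h : Setting ρ X Y Z) (hs : Saturates ρ X Y Z)
    (hne : U ρ X * U ρ Y ≠ 0) : ∃ a b : ℝ, a ≠ 0 ∧ b ≠ 0 ∧
      skewPart (sqrtOp ρ) X = (a : ℂ) • antiPart (sqrtOp ρ) (centred ρ Y) ∧
      skewPart (sqrtOp ρ) Y = (b : ℂ) • antiPart (sqrtOp ρ) (centred ρ X) := by
  have hB := sqrtOp_isHermitian ρ
  have hρ := h.state.1.isHermitian
  have h1 := h.sq_le
  have h2 := h.sq_le'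
  have hpos : 0 < U ρ X * U ρ Y := lt_of_le_of_ne
    (mul_nonneg (Real.sqrt_nonneg _) (Real.sqrt_nonneg _)) hne.symm
  rw [Saturates] at hs
  have hS := h.U_mul_U
  have hP := mul_nonneg h.skewInfo_nonneg h.swap.antiInfo_nonneg
  have hQ := mul_nonneg h.swap.skewInfo_nonneg h.antiInfo_nonneg
  have hPQ : (skewInfo ρ X * antiInfo ρ Y) * (skewInfo ρ Y * antiInfo ρ X) =
      (1 / 4 * ‖(ρ * Z).trace‖ ^ 2) ^ 2 := by
    rw [← hs, hS, Real.sq_sqrt (mul_nonneg hP hQ)]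
  rw [hs] at hpos
  -- With `T = ‖tr ρZ‖²`, both crosswise products are at least `T/4` while their product is `(T/4)²
  -- > 0`; neither can be larger.
  have hPe : ‖(ρ * Z).trace‖ ^ 2 = 4 * (skewInfo ρ X * antiInfo ρ Y) := by nlinarith
  have hQe : ‖(ρ * Z).trace‖ ^ 2 = 4 * (skewInfo ρ Y * antiInfo ρ X) := by nlinarith
  have key : ∀ {X Y Z : Op N}, Setting ρ X Y Z → 0 < ‖(ρ * Z).trace‖ ^ 2 →
      ‖(ρ * Z).trace‖ ^ 2 = 4 * (skewInfo ρ X * antiInfo ρ Y) →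
      ∃ a : ℝ, a ≠ 0 ∧ skewPart (sqrtOp ρ) X = (a : ℂ) • antiPart (sqrtOp ρ) (centred ρ Y) := by
    intro X Y Z h hpos he
    have hC := skewPart_isHermitian hB h.hX
    have hD := antiPart_isHermitian hB (centred_isHermitian hρ h.hY)
    rw [skewInfo_eq h.state.1, antiInfo_eq, h.trace_eq, norm_real, Real.norm_eq_abs, sq_abs] at he
    rw [h.trace_eq, norm_real, Real.norm_eq_abs, sq_abs] at hpos
    have hD0 : antiPart (sqrtOp ρ) (centred ρ Y) ≠ 0 := by
      intro h0
      rw [h0] at hpos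
      simp [traceForm] at hpos
    obtain ⟨a, ha⟩ := eq_smul_of_traceForm_sq_eq hC hD hD0 (by rw [he]; ring)
    refine ⟨a, ?_, ha⟩
    rintro rfl
    rw [ha] at hpos
    simp [traceForm] at hpos
  obtain ⟨a, ha, h3⟩ := key h (by linarith) hPe
  obtain ⟨b, hb, h4⟩ := key h.swap (by simpa using hpos) (by simpa using hQe)
  exact ⟨a, b, ha, hb, h3, h4⟩

end Uncertainty

/-! ### The commutation relations -/

section Algebra

open Complex
variable {N : ℕ}

/-- The matrix element `⟨j,m+1| J₊ |j,m⟩` for `m = k - j`. -/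
noncomputable def ladder (N k : ℕ) : ℝ := Real.sqrt (((k : ℝ) + 1) * ((N : ℝ) - k))

theorem ladder_sq {k : ℕ} (h : k ≤ N) : ladder N k ^ 2 = ((k : ℝ) + 1) * ((N : ℝ) - k) := by
  have : (k : ℝ) ≤ N := by exact_mod_cast h
  exact Real.sq_sqrt (mul_nonneg (by positivity) (by linarith))

theorem ladder_pos {k : ℕ} (h : k < N) : 0 < ladder N k := by
  have : (k : ℝ) < N := by exact_mod_cast h
  exact Real.sqrt_pos.2 (mul_pos (by positivity) (by linarith))

theorem Jplus_apply (a b : Fin (N + 1)) :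
    Jplus N a b = if (a : ℕ) = b + 1 then (ladder N b : ℂ) else 0 := by
  simp only [Jplus, of_apply, ladder, mag]
  rw [show ((N : ℝ) / 2 - ((b : ℕ) - (N : ℝ) / 2)) * ((N : ℝ) / 2 + ((b : ℕ) - (N : ℝ) / 2) + 1) =
    (((b : ℕ) : ℝ) + 1) * ((N : ℝ) - (b : ℕ)) by ring]

theorem Jminus_apply (a b : Fin (N + 1)) :
    Jminus N a b = if (b : ℕ) = a + 1 then (ladder N a : ℂ) else 0 := by
  simp only [Jminus, of_apply, ladder, mag, eq_comm (a := (b : ℕ))]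
  split_ifs with h
  · rw [← h]
    congr 2
    push_cast
    ring
  · rfl

theorem Jplus_conjTranspose : (Jplus N)ᴴ = Jminus N := by
  ext a b
  rw [conjTranspose_apply, Jplus_apply, Jminus_apply]
  split_ifs <;> simp

theorem Jminus_conjTranspose : (Jminus N)ᴴ = Jplus N := by
  rw [← Jplus_conjTranspose, conjTranspose_conjTranspose]

theorem Jz_mul_Jplus : Jz N * Jplus N = Jplus N * Jz N + Jplus N := by
  ext a b
  rw [Matrix.add_apply, Jz, diagonal_mul, mul_diagonal, Jplus_apply, mag, mag]
  split_ifs with h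
  · rw [h]; push_cast; ring
  · simp

theorem Jz_mul_Jminus : Jz N * Jminus N = Jminus N * Jz N - Jminus N := by
  ext a b
  rw [Matrix.sub_apply, Jz, diagonal_mul, mul_diagonal, Jminus_apply, mag, mag]
  split_ifs with h
  · rw [h]; push_cast; ring
  · simp

theorem Jplus_mul_Jminus :
    Jplus N * Jminus N = diagonal fun a : Fin (N + 1) => (((a : ℝ) * ((N : ℝ) - a + 1) : ℝ) : ℂ) := by
  ext a b
  rw [mul_apply]
  -- Row `0` is separate: nothing is raised into the lowest state, and the factor `a` on the right
  -- vanishes there.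
  refine Fin.cases ?_ (fun k => ?_) a
  · rw [Finset.sum_eq_zero]
    · simp [diagonal_apply]
    · intro k _
      simp [Jplus_apply]
  · rw [Finset.sum_eq_single k.castSucc]
    · rw [Jplus_apply, Jminus_apply, diagonal_apply]
      simp only [Fin.val_succ, Fin.val_castSucc, if_true, Fin.ext_iff, eq_comm (a := (b : ℕ))]
      split_ifs with h
      · rw [← ofReal_mul, ← sq, ladder_sq k.2.le]
        push_cast
        ring
      · simp
    · intro l _ hl
      rw [Jplus_apply, if_neg, zero_mul]
      intro h
      apply hl
      ext
      simpa using h.symm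
    · simp

theorem Jminus_mul_Jplus :
    Jminus N * Jplus N = diagonal fun a : Fin (N + 1) => ((((a : ℝ) + 1) * ((N : ℝ) - a) : ℝ) : ℂ) := by
  ext a b
  rw [mul_apply]
  refine Fin.lastCases ?_ (fun k => ?_) a
  · rw [Finset.sum_eq_zero]
    · simp [diagonal_apply]
    · intro k _
      rw [Jminus_apply, if_neg, zero_mul]
      have := k.2
      simp only [Fin.val_last]
      omega
  · rw [Finset.sum_eq_single k.succ]
    · rw [Jplus_apply, Jminus_apply, diagonal_apply]
      simp only [Fin.val_succ, Fin.val_castSucc, if_true, Fin.ext_iff, add_left_inj]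
      split_ifs with h
      · rw [← h, ← ofReal_mul, ← sq, ladder_sq k.2.le]
      · simp
    · intro l _ hl
      rw [Jminus_apply, if_neg, zero_mul]
      intro h
      apply hl
      ext
      simpa using h
    · simp

theorem Jplus_Jminus_comm :
    Jplus N * Jminus N - Jminus N * Jplus N = (2 : ℂ) • Jz N := by
  rw [Jplus_mul_Jminus, Jminus_mul_Jplus, Jz, diagonal_sub, ← diagonal_smul]
  congr 1
  ext a
  simp only [mag, Pi.smul_apply, smul_eq_mul]
  push_cast
  ring

theorem Jy_eq : Jy N = (-(I / 2)) • (Jplus N - Jminus N) := by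
  rw [Jy]
  congr 1
  field_simp
  simp

theorem Jx_isHermitian : (Jx N).IsHermitian := by
  simp [IsHermitian, Jx, conjTranspose_smul, Jplus_conjTranspose, Jminus_conjTranspose, add_comm]

theorem Jy_isHermitian : (Jy N).IsHermitian := by
  rw [IsHermitian, Jy_eq, conjTranspose_smul, conjTranspose_sub, Jplus_conjTranspose,
    Jminus_conjTranspose, ← neg_sub (Jplus N), smul_neg, ← neg_smul]
  congr 1
  simp [neg_div]

theorem Jz_isHermitian : (Jz N).IsHermitian := by
  rw [IsHermitian, Jz, diagonal_conjTranspose]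
  congr 1
  ext
  simp

theorem Jx_Jy_comm : Jx N * Jy N - Jy N * Jx N = I • Jz N := by
  rw [Jy_eq, Jx]
  simp only [smul_mul_smul_comm, mul_sub, add_mul, sub_mul, mul_add]
  linear_combination (norm := module) (I / 2) • Jplus_Jminus_comm (N := N)

theorem Jy_Jz_comm : Jy N * Jz N - Jz N * Jy N = I • Jx N := by
  rw [Jy_eq, Jx]
  simp only [smul_mul_assoc, mul_smul_comm, mul_sub, sub_mul]
  linear_combination (norm := module) (I / 2) • Jz_mul_Jplus (N := N) - (I / 2) • Jz_mul_Jminus (N := N)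

theorem Jz_Jx_comm : Jz N * Jx N - Jx N * Jz N = I • Jy N := by
  have hI : I * I = -1 := I_mul_I
  rw [Jy_eq, Jx, smul_smul, show I * -(I / 2) = 1 / 2 by linear_combination (-1 / 2) * hI]
  simp only [smul_mul_assoc, mul_smul_comm, mul_add, add_mul]
  linear_combination (norm := module) (1 / 2 : ℂ) • Jz_mul_Jplus (N := N)
    + (1 / 2 : ℂ) • Jz_mul_Jminus (N := N)

/-- The angular momentum along a vector given by its coordinates. -/
noncomputable def ang (N : ℕ) (v : Fin 3 → ℝ) : Op N := J N (WithLp.toLp 2 v)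

theorem ang_def (v : Fin 3 → ℝ) :
    ang N v = (v 0 : ℂ) • Jx N + (v 1 : ℂ) • Jy N + (v 2 : ℂ) • Jz N := rfl

theorem J_eq_ang (v : EuclideanSpace ℝ (Fin 3)) : J N v = ang N v.ofLp := rfl

theorem ang_add (u v : Fin 3 → ℝ) : ang N (u + v) = ang N u + ang N v := by
  simp only [ang_def, Pi.add_apply, ofReal_add]; module

theorem ang_smul (c : ℝ) (v : Fin 3 → ℝ) : ang N (c • v) = (c : ℂ) • ang N v := by
  simp only [ang_def, Pi.smul_apply, smul_eq_mul, ofReal_mul]; module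

theorem ang_neg (v : Fin 3 → ℝ) : ang N (-v) = -ang N v := by
  simp only [ang_def, Pi.neg_apply, ofReal_neg]; module

theorem ang_x : ang N (Pi.single 0 1) = Jx N := by simp [ang_def]
theorem ang_y : ang N (Pi.single 1 1) = Jy N := by simp [ang_def]
theorem ang_z : ang N (Pi.single 2 1) = Jz N := by simp [ang_def]

theorem ang_isHermitian (v : Fin 3 → ℝ) : (ang N v).IsHermitian := by
  simp [IsHermitian, ang_def, conjTranspose_smul, Jx_isHermitian.eq, Jy_isHermitian.eq,
    Jz_isHermitian.eq]

theorem ang_comm (u v : Fin 3 → ℝ) :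
    ang N u * ang N v - ang N v * ang N u = I • ang N (crossProduct u v) := by
  simp only [ang_def, cross_apply, cons_val_zero, cons_val_one, cons_val, ofReal_sub, ofReal_mul]
  simp only [smul_mul_smul_comm, mul_add, add_mul]
  linear_combination (norm := module) ((u 0 : ℂ) * v 1 - u 1 * v 0) • Jx_Jy_comm (N := N)
    + ((u 1 : ℂ) * v 2 - u 2 * v 1) • Jy_Jz_comm (N := N)
    + ((u 2 : ℂ) * v 0 - u 0 * v 2) • Jz_Jx_comm (N := N)

end Algebra

/-! ### Exponentials -/

section Exp

open Complex
variable {N : ℕ}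

theorem exp_mul_eq_of_semiconj {E A B : Op N} (h : A * E = E * B) :
    NormedSpace.exp A * E = E * NormedSpace.exp B := by
  let _ : NormedRing (Op N) := Matrix.linftyOpNormedRing
  let _ : NormedAlgebra ℚ (Op N) := Matrix.linftyOpNormedAlgebra
  let _ : NormedSpace ℂ (Op N) := Matrix.linftyOpNormedSpace
  have _ : CompleteSpace (Op N) := FiniteDimensional.complete ℂ (Op N)
  exact (SemiconjBy.exp_right (x := E) (a := B) (b := A) h.symm).eq.symm

theorem exp_smul_one (c : ℂ) : NormedSpace.exp (c • (1 : Op N)) = exp c • (1 : Op N) := by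
  rw [smul_one_eq_diagonal, exp_diagonal, smul_one_eq_diagonal]
  congr 1
  ext i
  rw [Pi.coe_exp, exp_eq_exp_ℂ]

theorem exp_mul_eigen {A E : Op N} {e : ℂ} (h : A * E = E * A + e • E) (c : ℂ) :
    NormedSpace.exp (c • A) * E = exp (c * e) • (E * NormedSpace.exp (c • A)) := by
  have h1 : (c • A) * E = E * (c • A + (c * e) • 1) := by
    rw [smul_mul_assoc, h]
    simp [mul_add, smul_smul]
  rw [exp_mul_eq_of_semiconj h1, exp_add_of_commute _ _ ((Commute.one_right _).smul_right _),
    exp_smul_one]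
  simp

/-- `P ± iQ` are eigenvectors of `[A, ·]` with eigenvalues `±1`, so the exponential moves past each
at the cost of a phase. The angle is complex because an imaginary one yields the squeezing
`e^{βJ_z}`. -/
theorem exp_mul_rotate {A P Q : Op N} (hP : A * P - P * A = I • Q) (hQ : A * Q - Q * A = -(I • P))
    (t : ℂ) : NormedSpace.exp ((-(I * t)) • A) * P =
      (cos t • P + sin t • Q) * NormedSpace.exp ((-(I * t)) • A) := by
  have hI : I * I = -1 := I_mul_I
  have h1 : A * (P + I • Q) = (P + I • Q) * A + (1 : ℂ) • (P + I • Q) := by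
    rw [mul_add, add_mul, mul_smul_comm, smul_mul_assoc]
    linear_combination (norm := module) hP + I • hQ - hI • P
  have h2 : A * (P - I • Q) = (P - I • Q) * A + (-1 : ℂ) • (P - I • Q) := by
    rw [mul_sub, sub_mul, mul_smul_comm, smul_mul_assoc]
    linear_combination (norm := module) hP - I • hQ + hI • P
  have e1 := exp_mul_eigen h1 (-(I * t))
  have e2 := exp_mul_eigen h2 (-(I * t))
  set X := NormedSpace.exp ((-(I * t)) • A)
  rw [show exp (-(I * t) * 1) = cos t - sin t * I by
    rw [mul_one, show -(I * t) = -t * I by ring, exp_mul_I, cos_neg, sin_neg]; ring] at e1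
  rw [show exp (-(I * t) * -1) = cos t + sin t * I by
    rw [mul_neg_one, neg_neg, mul_comm, exp_mul_I]] at e2
  simp only [mul_add, mul_sub, add_mul, sub_mul, mul_smul_comm, smul_mul_assoc] at e1 e2 ⊢
  linear_combination (norm := module) (1 / 2 : ℂ) • e1 + (1 / 2 : ℂ) • e2 - sin t • hI • (Q * X)

theorem conjTranspose_exp_smul {A : Op N} (hA : A.IsHermitian) (t : ℝ) :
    (NormedSpace.exp ((-(I * (t : ℂ))) • A))ᴴ = NormedSpace.exp ((I * (t : ℂ)) • A) := by
  rw [← exp_conjTranspose, conjTranspose_smul, hA.eq]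
  simp

theorem exp_mul_exp_neg (A : Op N) : NormedSpace.exp A * NormedSpace.exp (-A) = 1 := by
  rw [← exp_add_of_commute _ _ (Commute.neg_right (Commute.refl A)), add_neg_cancel,
    NormedSpace.exp_zero]

theorem exp_smul_mul_conjTranspose {A : Op N} (hA : A.IsHermitian) (t : ℝ) :
    NormedSpace.exp ((-(I * (t : ℂ))) • A) * (NormedSpace.exp ((-(I * (t : ℂ))) • A))ᴴ = 1 := by
  rw [conjTranspose_exp_smul hA, ← exp_mul_exp_neg ((-(I * (t : ℂ))) • A), ← neg_smul, neg_neg]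

end Exp

/-! ### Rotations of `ℝ³` -/

section Space

/-- Rodrigues' formula for the rotation by `t` about the unit vector `w`. -/
noncomputable def rot (w : Fin 3 → ℝ) (t : ℝ) (v : Fin 3 → ℝ) : Fin 3 → ℝ :=
  Real.cos t • v + Real.sin t • crossProduct w v + ((1 - Real.cos t) * (w ⬝ᵥ v)) • w

theorem rot_add (w : Fin 3 → ℝ) (t : ℝ) (u v : Fin 3 → ℝ) :
    rot w t (u + v) = rot w t u + rot w t v := by
  simp only [rot, map_add, dotProduct_add]; module

theorem rot_smul (w : Fin 3 → ℝ) (t c : ℝ) (v : Fin 3 → ℝ) : rot w t (c • v) = c • rot w t v := by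
  simp only [rot, map_smul, dotProduct_smul, smul_eq_mul]; module

theorem rot_dotProduct {w : Fin 3 → ℝ} (hw : w ⬝ᵥ w = 1) (t : ℝ) (u v : Fin 3 → ℝ) :
    rot w t u ⬝ᵥ rot w t v = u ⬝ᵥ v := by
  have hcs := Real.cos_sq_add_sin_sq t
  have h1 : crossProduct w u ⬝ᵥ crossProduct w v = u ⬝ᵥ v - (w ⬝ᵥ v) * (w ⬝ᵥ u) := by
    rw [cross_dot_cross, hw, one_mul, dotProduct_comm u w]
  have h2 : crossProduct w u ⬝ᵥ v = -(u ⬝ᵥ crossProduct w v) := by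
    rw [dotProduct_comm, triple_product_permutation, ← cross_anticomm, dotProduct_neg,
      triple_product_permutation, triple_product_permutation]
  have h3 : w ⬝ᵥ crossProduct w v = 0 := dot_self_cross w v
  have h4 : crossProduct w u ⬝ᵥ w = 0 := by rw [dotProduct_comm, dot_self_cross]
  simp only [rot, add_dotProduct, dotProduct_add, smul_dotProduct, dotProduct_smul, smul_eq_mul,
    h1, h2, h3, h4, hw, dotProduct_comm u w]
  linear_combination (u ⬝ᵥ v - (w ⬝ᵥ u) * (w ⬝ᵥ v)) * hcs

theorem cross_cross_unit {w u : Fin 3 → ℝ} (hw : w ⬝ᵥ w = 1) (hwu : w ⬝ᵥ u = 0) :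
    crossProduct w (crossProduct w u) = -u := by
  rw [cross_cross_eq_smul_sub_smul', hw, hwu]; simp

/-- With `v = w × u`, evaluate `v × (x × v)` in two ways: one gives `x` minus its `v`-component, the
other the components along `w` and `u`. -/
theorem frame_expand {w u : Fin 3 → ℝ} (hw : w ⬝ᵥ w = 1) (hu : u ⬝ᵥ u = 1) (hwu : w ⬝ᵥ u = 0)
    (x : Fin 3 → ℝ) : x = (w ⬝ᵥ x) • w + (u ⬝ᵥ x) • u +
      (crossProduct w u ⬝ᵥ x) • crossProduct w u := by
  have hvv : crossProduct w u ⬝ᵥ crossProduct w u = 1 := by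
    rw [cross_dot_cross, hw, hu, hwu]; simp
  have h1 := cross_cross_eq_smul_sub_smul' (crossProduct w u) x (crossProduct w u)
  rw [cross_cross_eq_smul_sub_smul' x w u, map_sub, map_smul, map_smul,
    cross_cross_eq_smul_sub_smul w u w, cross_cross_eq_smul_sub_smul w u u, hw, hu, hvv,
    dotProduct_comm u w, hwu] at h1
  rw [dotProduct_comm x u, dotProduct_comm x] at h1
  simp only [one_smul, zero_smul, sub_zero, zero_sub, smul_neg, sub_neg_eq_add] at h1
  rw [add_comm (_ • w), h1, sub_add_cancel]

theorem exists_unit_orthogonal (w : Fin 3 → ℝ) : ∃ u : Fin 3 → ℝ, u ⬝ᵥ u = 1 ∧ w ⬝ᵥ u = 0 := by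
  have norm : ∀ u : Fin 3 → ℝ, u ≠ 0 → w ⬝ᵥ u = 0 → ∃ u : Fin 3 → ℝ, u ⬝ᵥ u = 1 ∧ w ⬝ᵥ u = 0 := by
    intro u hu h
    have h0 : 0 < u ⬝ᵥ u := lt_of_le_of_ne (Finset.sum_nonneg fun i _ => mul_self_nonneg _)
      (fun h => hu (dotProduct_self_eq_zero.1 h.symm))
    refine ⟨(Real.sqrt (u ⬝ᵥ u))⁻¹ • u, ?_, by rw [dotProduct_smul, h, smul_zero]⟩
    rw [smul_dotProduct, dotProduct_smul, smul_eq_mul, smul_eq_mul, ← mul_assoc, ← mul_inv,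
      Real.mul_self_sqrt h0.le, inv_mul_cancel₀ h0.ne']
  by_cases h : w 0 = 0 ∧ w 1 = 0
  · refine norm ![1, 0, 0] (fun h => by simpa using congrFun h 0) ?_
    simp [dotProduct, Fin.sum_univ_three, h]
  · refine norm ![-w 1, w 0, 0] (fun h' => h ⟨by simpa using congrFun h' 1,
      by simpa using congrFun h' 0⟩) ?_
    simp [dotProduct, Fin.sum_univ_three]
    ring

theorem exists_cos_sin {α β : ℝ} (h : α ^ 2 + β ^ 2 = 1) : ∃ t : ℝ, Real.cos t = α ∧ Real.sin t = β := by
  have hn : ‖(⟨α, β⟩ : ℂ)‖ = 1 := by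
    rw [Complex.norm_def, Complex.normSq_mk, ← sq, ← sq, h, Real.sqrt_one]
  have h0 : (⟨α, β⟩ : ℂ) ≠ 0 := by
    rw [← norm_ne_zero_iff, hn]; exact one_ne_zero
  exact ⟨Complex.arg ⟨α, β⟩, by rw [Complex.cos_arg h0, hn, div_one],
    by rw [Complex.sin_arg, hn, div_one]⟩

/-- Euler's rotation theorem. -/
theorem exists_rot {a b : Fin 3 → ℝ} (ha : a ⬝ᵥ a = 1) (hb : b ⬝ᵥ b = 1) (hab : a ⬝ᵥ b = 0) :
    ∃ (w : Fin 3 → ℝ) (t : ℝ), w ⬝ᵥ w = 1 ∧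
      rot w t (Pi.single 0 1) = a ∧ rot w t (Pi.single 1 1) = b := by
  set c := crossProduct a b with hc
  have hcc : c ⬝ᵥ c = 1 := by rw [hc, cross_dot_cross, ha, hb, hab]; simp
  have hac : a ⬝ᵥ c = 0 := dot_self_cross a b
  have hbc : b ⬝ᵥ c = 0 := dot_cross_self a b
  have hca : crossProduct c a = b := by
    rw [hc, cross_cross_eq_smul_sub_smul, ha, dotProduct_comm b a, hab]; simp
  have hcb : crossProduct c b = -a := by
    rw [hc, cross_cross_eq_smul_sub_smul, hb, hab]; simp
  have hba : crossProduct b a = -c := by rw [← cross_anticomm]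
  have hac' : crossProduct a c = -b := by rw [← cross_anticomm, hca]
  have hbc' : crossProduct b c = a := by rw [← cross_anticomm, hcb, neg_neg]
  -- Taking `a × b` as third column makes this orthogonal matrix have determinant `1`.
  set A : Matrix (Fin 3) (Fin 3) ℝ := (of ![a, b, c])ᵀ with hA
  have hmul : ∀ x, A *ᵥ x = x 0 • a + x 1 • b + x 2 • c := by
    intro x
    ext i
    simp [hA, mulVec, dotProduct, Fin.sum_univ_three, mul_comm]
  have hdot : ∀ x y, (A *ᵥ x) ⬝ᵥ (A *ᵥ y) = x ⬝ᵥ y := by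
    intro x y
    simp only [hmul, add_dotProduct, dotProduct_add, smul_dotProduct, dotProduct_smul, ha, hb, hcc,
      hab, hac, hbc, dotProduct_comm b a, dotProduct_comm c a, dotProduct_comm c b]
    simp [dotProduct, Fin.sum_univ_three]
    ring
  have hcross : ∀ x y, crossProduct (A *ᵥ x) (A *ᵥ y) = A *ᵥ (crossProduct x y) := by
    intro x y
    simp only [hmul, map_add, map_smul, LinearMap.add_apply, LinearMap.smul_apply, cross_self,
      hca, hcb, hba, hac', hbc', ← hc, cross_apply, cons_val_zero, cons_val_one, cons_val]
    module
  have hdet : A.det = 1 := by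
    rw [hA, det_transpose, show (of ![a, b, c] : Matrix (Fin 3) (Fin 3) ℝ) = ![a, b, c] from rfl,
      ← triple_product_eq_det, hbc', ha]
  have hAA : A * Aᵀ = 1 := by
    rw [mul_eq_one_comm]
    ext i j
    have := hdot (Pi.single i 1) (Pi.single j 1)
    rw [dotProduct_mulVec, vecMul_mulVec, ← dotProduct_mulVec] at this
    simpa [one_apply, Pi.single_apply, eq_comm] using this
  have hdet1 : (A - 1).det = 0 := by
    -- `A(1 - Aᵀ) = A - 1` and the dimension is odd, so `1` is an eigenvalue; its eigenvector is the
    -- axis.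
    have h : (A - 1).det = -(A - 1).det := by
      calc (A - 1).det = (A * (-(A - 1))ᵀ).det := by
            rw [← det_transpose (A - 1), transpose_neg, transpose_sub, transpose_one,
              ← det_transpose]
            congr 1
            rw [transpose_sub, transpose_one, transpose_transpose, neg_sub, mul_sub, hAA, mul_one]
        _ = -(A - 1).det := by
            rw [det_mul, hdet, one_mul, det_transpose, det_neg, Fintype.card_fin]; ring
    linarith
  obtain ⟨w₀, hw₀, hw₁⟩ := exists_mulVec_eq_zero_iff.2 hdet1
  rw [sub_mulVec, one_mulVec, sub_eq_zero] at hw₁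
  have hpos : 0 < w₀ ⬝ᵥ w₀ := lt_of_le_of_ne (Finset.sum_nonneg fun i _ => mul_self_nonneg _)
    (fun h => hw₀ (dotProduct_self_eq_zero.1 h.symm))
  obtain ⟨w, hw, hAw⟩ : ∃ w, w ⬝ᵥ w = 1 ∧ A *ᵥ w = w := by
    refine ⟨(Real.sqrt (w₀ ⬝ᵥ w₀))⁻¹ • w₀, ?_, by rw [mulVec_smul, hw₁]⟩
    rw [smul_dotProduct, dotProduct_smul, smul_eq_mul, smul_eq_mul, ← mul_assoc, ← mul_inv,
      Real.mul_self_sqrt hpos.le, inv_mul_cancel₀ hpos.ne']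
  obtain ⟨u, hu, hwu⟩ := exists_unit_orthogonal w
  -- `A` fixes `w` and preserves inner products, so it maps the plane orthogonal to `w` to itself;
  -- the two coordinates of `Au` there become the cosine and sine of the angle.
  have hAu : A *ᵥ u = (u ⬝ᵥ A *ᵥ u) • u + (crossProduct w u ⬝ᵥ A *ᵥ u) • crossProduct w u := by
    have h := frame_expand hw hu hwu (A *ᵥ u)
    have h0 : w ⬝ᵥ A *ᵥ u = 0 := by
      nth_rewrite 1 [← hAw]
      rw [hdot, hwu]
    rwa [h0, zero_smul, zero_add] at h
  have hvv : crossProduct w u ⬝ᵥ crossProduct w u = 1 := by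
    rw [cross_dot_cross, hw, hu, hwu]; simp
  have huv : u ⬝ᵥ crossProduct w u = 0 := dot_cross_self w u
  obtain ⟨t, hcos, hsin⟩ := exists_cos_sin
      (α := u ⬝ᵥ A *ᵥ u) (β := crossProduct w u ⬝ᵥ A *ᵥ u) (by
    have h := hdot u u
    rw [hu, hAu] at h
    simp only [add_dotProduct, dotProduct_add, smul_dotProduct, dotProduct_smul, hu, hvv, huv,
      dotProduct_comm _ u, smul_eq_mul] at h
    linarith)
  rw [← hcos, ← hsin] at hAu
  have hwv : w ⬝ᵥ crossProduct w u = 0 := dot_self_cross w u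
  have hwwu := cross_cross_unit hw hwu
  have hAv : A *ᵥ crossProduct w u = Real.cos t • crossProduct w u - Real.sin t • u := by
    rw [← hcross, hAw, hAu, map_add, map_smul, map_smul, hwwu, smul_neg, sub_eq_add_neg]
  -- Both sides are linear, so it suffices to compare them on the frame `w`, `u`, `w × u`.
  have hrot : ∀ x, rot w t x = A *ᵥ x := by
    intro x
    rw [frame_expand hw hu hwu x]
    simp only [rot_add, rot_smul, mulVec_add, mulVec_smul, hAw, hAu, hAv]
    congr 1
    · congr 1
      · congr 1
        rw [rot, cross_self, hw]
        module
      · congr 1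
        rw [rot, hwu]
        module
    · congr 1
      rw [rot, hwv, hwwu]
      module
  refine ⟨w, t, hw, ?_, ?_⟩
  · rw [hrot, hmul]; simp
  · rw [hrot, hmul]; simp

end Space

/-! ### Rotation operators -/

section Rotation

open Complex
variable {N : ℕ}

/-- The part of `v` along `w` commutes with the exponential. The orthogonal part and its cross
product with `w` form a pair to which `exp_mul_rotate` applies. -/
theorem exp_mul_ang {w : Fin 3 → ℝ} (hw : w ⬝ᵥ w = 1) (t : ℝ) (v : Fin 3 → ℝ) :
    NormedSpace.exp ((-(I * (t : ℂ))) • ang N w) * ang N v =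
      ang N (rot w t v) * NormedSpace.exp ((-(I * (t : ℂ))) • ang N w) := by
  have hwp : w ⬝ᵥ (v - (w ⬝ᵥ v) • w) = 0 := by simp [dotProduct_sub, dotProduct_smul, hw]
  have hq : crossProduct w (v - (w ⬝ᵥ v) • w) = crossProduct w v := by simp
  have hP := ang_comm (N := N) w (v - (w ⬝ᵥ v) • w)
  have hQ := ang_comm (N := N) w (crossProduct w (v - (w ⬝ᵥ v) • w))
  rw [cross_cross_unit hw hwp, ang_neg, smul_neg] at hQ
  have h := exp_mul_rotate hP hQ t
  rw [hq] at h
  have hc := exp_mul_eq_of_semiconj (A := (-(I * (t : ℂ))) • ang N w)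
    (B := (-(I * (t : ℂ))) • ang N w) (E := ang N w) (by simp)
  have e1 : v = (v - (w ⬝ᵥ v) • w) + (w ⬝ᵥ v) • w := by simp
  have e2 : rot w t v = Real.cos t • (v - (w ⬝ᵥ v) • w) + Real.sin t • crossProduct w v +
      (w ⬝ᵥ v) • w := by
    rw [rot]; module
  rw [e2]
  nth_rewrite 1 [e1]
  rw [ang_add, ang_add, ang_add, ang_smul, ang_smul, ang_smul, mul_add, h, mul_smul_comm, hc,
    ofReal_cos, ofReal_sin, add_mul _ (((w ⬝ᵥ v : ℝ) : ℂ) • ang N w), smul_mul_assoc]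

theorem mul_mul_conjTranspose_eq {R A B : Op N} (hR : R * Rᴴ = 1) (h : R * A = B * R) :
    R * A * Rᴴ = B := by
  rw [h, mul_assoc, hR, mul_one]

theorem exp_ang_conj {w : Fin 3 → ℝ} (hw : w ⬝ᵥ w = 1) (t : ℝ) (v : Fin 3 → ℝ) :
    NormedSpace.exp ((-(I * (t : ℂ))) • ang N w) * ang N v *
      (NormedSpace.exp ((-(I * (t : ℂ))) • ang N w))ᴴ = ang N (rot w t v) :=
  mul_mul_conjTranspose_eq (exp_smul_mul_conjTranspose (ang_isHermitian w) t) (exp_mul_ang hw t v)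

theorem dotProduct_self_of_norm {w : EuclideanSpace ℝ (Fin 3)} :
    ‖w‖ = 1 ↔ w.ofLp ⬝ᵥ w.ofLp = 1 := by
  rw [EuclideanSpace.norm_eq, Real.sqrt_eq_one]
  simp [dotProduct, sq]

theorem isRotation_exp_ang {w : Fin 3 → ℝ} (hw : w ⬝ᵥ w = 1) (t : ℝ) :
    IsRotation (NormedSpace.exp ((-(I * (t : ℂ))) • ang N w)) :=
  ⟨t, WithLp.toLp 2 w, dotProduct_self_of_norm.2 hw, rfl⟩

theorem IsRotation.exists_ang {R : Op N} (hR : IsRotation R) :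
    ∃ (t : ℝ) (w : Fin 3 → ℝ), w ⬝ᵥ w = 1 ∧ R = NormedSpace.exp ((-(I * (t : ℂ))) • ang N w) := by
  obtain ⟨t, w, hw, rfl⟩ := hR
  exact ⟨t, w.ofLp, dotProduct_self_of_norm.1 hw, rfl⟩

theorem IsRotation.mul_conjTranspose {R : Op N} (hR : IsRotation R) : R * Rᴴ = 1 := by
  obtain ⟨t, w, -, rfl⟩ := hR.exists_ang
  exact exp_smul_mul_conjTranspose (ang_isHermitian w) t

theorem IsRotation.conjTranspose_mul {R : Op N} (hR : IsRotation R) : Rᴴ * R = 1 :=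
  mul_eq_one_comm.1 hR.mul_conjTranspose

theorem orthonormal_iff_dotProduct {n : Fin 3 → EuclideanSpace ℝ (Fin 3)} :
    Orthonormal ℝ n ↔ ∀ i j, (n i).ofLp ⬝ᵥ (n j).ofLp = if i = j then 1 else 0 := by
  rw [orthonormal_iff_ite]
  simp only [EuclideanSpace.inner_eq_star_dotProduct, star_trivial]
  exact forall₂_congr fun i j => by rw [dotProduct_comm]

/-- Conjugation preserves commutators, so the images of `J_x` and `J_y` already determine that of
`J_z`. -/
theorem conj_Jz {V : Op N} (hV : Vᴴ * V = 1) {a b : Fin 3 → ℝ} (h0 : V * Jx N * Vᴴ = ang N a)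
    (h1 : V * Jy N * Vᴴ = ang N b) : V * Jz N * Vᴴ = ang N (crossProduct a b) := by
  have h : I • (V * Jz N * Vᴴ) = I • ang N (crossProduct a b) := by
    rw [← ang_comm, ← h0, ← h1, ← smul_mul_assoc, ← mul_smul_comm, ← Jx_Jy_comm]
    have e : ∀ A B : Op N, V * A * Vᴴ * (V * B * Vᴴ) = V * (A * B) * Vᴴ := fun A B => by
      calc V * A * Vᴴ * (V * B * Vᴴ) = V * A * (Vᴴ * V) * B * Vᴴ := by simp only [mul_assoc]
        _ = V * (A * B) * Vᴴ := by rw [hV, mul_one]; simp only [mul_assoc]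
    rw [e, e, mul_sub, sub_mul]
  exact smul_right_injective _ I_ne_zero h

theorem exists_rotation {a b : Fin 3 → ℝ} (ha : a ⬝ᵥ a = 1) (hb : b ⬝ᵥ b = 1)
    (hab : a ⬝ᵥ b = 0) : ∃ R : Op N, IsRotation R ∧ R * Jx N * Rᴴ = ang N a ∧
      R * Jy N * Rᴴ = ang N b := by
  obtain ⟨w, t, hw, h0, h1⟩ := exists_rot ha hb hab
  refine ⟨_, isRotation_exp_ang hw t, ?_, ?_⟩
  · rw [← ang_x, exp_ang_conj hw, h0]
  · rw [← ang_y, exp_ang_conj hw, h1]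

/-- Schur's lemma for the spin representation. -/
theorem commute_of_commute_Jx_Jy {W : Op N} (hx : Commute W (Jx N)) (hy : Commute W (Jy N))
    (A : Op N) : Commute W A := by
  have hz : Commute W (Jz N) := by
    have h : Commute W (I • Jz N) := by
      rw [← Jx_Jy_comm]
      exact (hx.mul_right hy).sub_right (hy.mul_right hx)
    have := h.smul_right (-I)
    rwa [smul_smul, neg_mul, I_mul_I, neg_neg, one_smul] at this
  have hp : Commute W (Jplus N) := by
    have : Jplus N = Jx N + I • Jy N := by
      rw [Jy_eq, Jx, smul_smul, mul_neg, ← mul_div_assoc, I_mul_I]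
      module
    rw [this]
    exact hx.add_right (hy.smul_right I)
  -- The spectrum of `J_z` is simple, so `W` is diagonal.
  have hd : ∀ i j, i ≠ j → W i j = 0 := by
    intro i j hij
    have h := congrFun₂ hz.eq i j
    rw [Jz, mul_diagonal, diagonal_mul, mul_comm, ← sub_eq_zero, ← sub_mul, mul_eq_zero] at h
    refine h.resolve_left fun h0 => hij ?_
    rw [sub_eq_zero, ofReal_inj, mag, mag] at h0
    have : (i : ℝ) = (j : ℝ) := by linarith
    exact Fin.ext (by exact_mod_cast this.symm) |>.symm
  -- The ladder coefficients do not vanish, so commuting with `J₊` equates neighbouring diagonal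
  -- entries.
  have hstep : ∀ k : Fin N, W k.succ k.succ = W k.castSucc k.castSucc := by
    intro k
    have h := congrFun₂ hp.eq k.succ k.castSucc
    rw [mul_apply, mul_apply, Finset.sum_eq_single k.succ, Finset.sum_eq_single k.castSucc] at h
    · rw [Jplus_apply] at h
      simp only [Fin.val_succ, Fin.val_castSucc, if_true] at h
      rw [mul_comm] at h
      exact mul_left_cancel₀ (ofReal_ne_zero.2 (ladder_pos k.2).ne') h
    · intro l _ hl
      rw [hd l _ hl, mul_zero]
    · simp
    · intro l _ hl
      rw [hd _ l hl.symm, zero_mul]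
    · simp
  have hconst : ∀ i, W i i = W 0 0 := by
    intro i
    induction i using Fin.induction with
    | zero => rfl
    | succ k ih => rw [hstep, ih]
  have hW : W = W 0 0 • (1 : Op N) := by
    ext i j
    rw [Matrix.smul_apply, one_apply]
    split_ifs with h
    · rw [← h, hconst, smul_eq_mul, mul_one]
    · rw [hd i j h, smul_zero]
  rw [hW]
  exact (Commute.one_left A).smul_left _

/-- `Vᴴ R` commutes with `J_x` and `J_y`, hence with everything by Schur's lemma. -/
theorem conj_eq_conj {R V : Op N} (hR : Rᴴ * R = 1) (hV : Vᴴ * V = 1)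
    (hx : R * Jx N * Rᴴ = V * Jx N * Vᴴ) (hy : R * Jy N * Rᴴ = V * Jy N * Vᴴ) (A : Op N) :
    R * A * Rᴴ = V * A * Vᴴ := by
  have key : ∀ A : Op N, R * A * Rᴴ = V * A * Vᴴ ↔ Commute (Vᴴ * R) A := by
    intro A
    have hR' := mul_eq_one_comm.1 hR
    have hV' := mul_eq_one_comm.1 hV
    constructor
    · intro h
      calc Vᴴ * R * A = Vᴴ * (R * A * Rᴴ) * R := by
            simp only [mul_assoc, hR, mul_one]
        _ = (Vᴴ * V) * A * (Vᴴ * R) := by rw [h]; simp only [mul_assoc]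
        _ = A * (Vᴴ * R) := by rw [hV, one_mul]
    · intro h
      calc R * A * Rᴴ = (V * Vᴴ) * R * A * Rᴴ := by rw [hV', one_mul]
        _ = V * (Vᴴ * R * A) * Rᴴ := by simp only [mul_assoc]
        _ = V * A * Vᴴ := by rw [h.eq]; simp only [mul_assoc, hR', mul_one]
  exact (key A).2 (commute_of_commute_Jx_Jy ((key _).1 hx) ((key _).1 hy) A)

end Rotation

/-! ### States attaining equality -/

section Equality

open Complex
open scoped ComplexOrder
variable {N : ℕ}

theorem setting_axes {ρ : Op N} (hρ : IsState ρ) : Setting ρ (Jx N) (Jy N) (Jz N) :=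
  ⟨hρ, Jx_isHermitian, Jy_isHermitian, Jx_Jy_comm⟩

theorem skewPart_eq_smul_iff {B X Y : Op N} {a : ℝ} :
    skewPart B X = (a : ℂ) • antiPart B Y ↔ B * X - X * B = (I * a) • (B * Y + Y * B) := by
  rw [skewPart, antiPart]
  constructor
  · intro h
    rw [← smul_smul, ← h, smul_smul]
    simp
  · intro h
    rw [h, smul_smul, ← mul_assoc]
    simp

/-- The recurrence says `[B,J₊] = a{B,J₊}` and `[B,J₋] = -a{B,J₋}` for `B = √ρ`. Recombined into
`J_x` and `J_y` these are the two proportionalities, with constants `a` and `-a`. -/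
theorem saturates_diagonal {b : Fin (N + 1) → ℝ} (hb : ∀ i, 0 ≤ b i) {a : ℝ}
    (hρ : IsState (diagonal fun i => ((b i ^ 2 : ℝ) : ℂ) : Op N))
    (hab : ∀ i k : Fin (N + 1), (i : ℕ) = k + 1 → (1 - a) * b i = (1 + a) * b k) :
    Saturates (diagonal fun i => ((b i ^ 2 : ℝ) : ℂ) : Op N) (Jx N) (Jy N) (Jz N) := by
  set ρ : Op N := diagonal fun i => ((b i ^ 2 : ℝ) : ℂ) with hρd
  set B : Op N := diagonal fun i => (b i : ℂ) with hB
  have hs : sqrtOp ρ = B := by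
    refine sqrtOp_eq (posSemidef_diagonal_iff.2 fun i => ?_) ?_
    · exact_mod_cast hb i
    · rw [hB, diagonal_mul_diagonal, hρd]
      congr 1
      ext i
      push_cast
      ring
  have hab' : ∀ i k : Fin (N + 1), (i : ℕ) = k + 1 →
      (b i : ℂ) - b k = a * (b i + b k) := by
    intro i k h
    have := hab i k h
    exact_mod_cast (by linarith : b i - b k = a * (b i + b k))
  have hP : B * Jplus N - Jplus N * B = (a : ℂ) • (B * Jplus N + Jplus N * B) := by
    ext i k
    simp only [hB, Matrix.sub_apply, Matrix.smul_apply, Matrix.add_apply, diagonal_mul,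
      mul_diagonal, Jplus_apply, smul_eq_mul]
    split_ifs with h
    · linear_combination (ladder N k : ℂ) * hab' i k h
    · simp
  have hM : B * Jminus N - Jminus N * B = -((a : ℂ) • (B * Jminus N + Jminus N * B)) := by
    ext i k
    simp only [hB, Matrix.sub_apply, Matrix.smul_apply, Matrix.add_apply, Matrix.neg_apply,
      diagonal_mul, mul_diagonal, Jminus_apply, smul_eq_mul]
    split_ifs with h
    · linear_combination -(ladder N i : ℂ) * hab' k i h
    · simp
  have tP : (ρ * Jplus N).trace = 0 := Finset.sum_eq_zero fun i _ => by
    simp [hρd, diagonal_mul, Jplus_apply]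
  have tM : (ρ * Jminus N).trace = 0 := Finset.sum_eq_zero fun i _ => by
    simp [hρd, diagonal_mul, Jminus_apply]
  have cX : centred ρ (Jx N) = Jx N := by
    rw [centred, Jx, mul_smul_comm, mul_add, trace_smul, trace_add, tP, tM]; simp
  have cY : centred ρ (Jy N) = Jy N := by
    rw [centred, Jy_eq, mul_smul_comm, mul_sub, trace_smul, trace_sub, tP, tM]; simp
  have hI : I * I = -1 := I_mul_I
  refine (setting_axes hρ).saturates_of_eq_smul (a := a) (b := -a) ?_ ?_
  · rw [skewPart_eq_smul_iff, hs, cY, Jx, Jy_eq]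
    simp only [mul_smul_comm, smul_mul_assoc, mul_add, mul_sub, add_mul, sub_mul] at hP hM ⊢
    linear_combination (norm := module) (1 / 2 : ℂ) • hP + (1 / 2 : ℂ) • hM +
      ((1 / 2 : ℂ) * a * hI) • (B * Jplus N + Jplus N * B - B * Jminus N - Jminus N * B)
  · rw [skewPart_eq_smul_iff, hs, cX, Jx, Jy_eq, ofReal_neg]
    simp only [mul_smul_comm, smul_mul_assoc, mul_add, mul_sub, add_mul, sub_mul] at hP hM ⊢
    linear_combination (norm := module) -(I / 2 : ℂ) • hP + (I / 2 : ℂ) • hM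

/-- The diagonal state with weights proportional to `r ^ (2 (j - n))`. -/
noncomputable def geo (N : ℕ) (r : ℝ) : Op N := diagonal fun i : Fin (N + 1) =>
  ((r ^ (2 * (N - (i : ℕ))) / ∑ k : Fin (N + 1), r ^ (2 * (N - (k : ℕ))) : ℝ) : ℂ)

theorem geo_sum_pos (N : ℕ) (r : ℝ) : 0 < ∑ k : Fin (N + 1), r ^ (2 * (N - (k : ℕ))) :=
  Finset.sum_pos' (fun k _ => by rw [pow_mul]; positivity)
    ⟨Fin.last N, Finset.mem_univ _, by simp⟩

theorem geo_abs (N : ℕ) (r : ℝ) : geo N |r| = geo N r := by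
  simp only [geo, pow_mul, sq_abs]

theorem geo_isState (N : ℕ) (r : ℝ) : IsState (geo N r) := by
  refine ⟨posSemidef_diagonal_iff.2 fun i => ?_, ?_⟩
  · have : 0 ≤ r ^ (2 * (N - (i : ℕ))) / ∑ k : Fin (N + 1), r ^ (2 * (N - (k : ℕ))) :=
      div_nonneg (by rw [pow_mul]; positivity) (geo_sum_pos N r).le
    exact_mod_cast this
  · rw [geo, trace_diagonal, ← ofReal_sum, ← Finset.sum_div, div_self (geo_sum_pos N r).ne',
      ofReal_one]

theorem geo_saturates (N : ℕ) (r : ℝ) : Saturates (geo N r) (Jx N) (Jy N) (Jz N) := by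
  -- Only even powers of `r` occur in the state, but its square root needs nonnegative entries.
  rw [← geo_abs]
  have h0 := abs_nonneg r
  generalize |r| = r at h0
  have hS := geo_sum_pos N r
  set S := ∑ k : Fin (N + 1), r ^ (2 * (N - (k : ℕ))) with hSd
  have e : geo N r = diagonal fun i : Fin (N + 1) =>
      (((r ^ (N - (i : ℕ)) * Real.sqrt S⁻¹) ^ 2 : ℝ) : ℂ) := by
    rw [geo, ← hSd]
    congr 1
    ext i
    rw [mul_pow, Real.sq_sqrt (inv_nonneg.2 hS.le), ← pow_mul, mul_comm 2, div_eq_mul_inv]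
  have hst := geo_isState N r
  rw [e] at hst ⊢
  -- This `a` solves `(1 - a)/(1 + a) = r`, the ratio of neighbouring entries of the root.
  refine saturates_diagonal (a := (1 - r) / (1 + r)) (fun i => by positivity) hst ?_
  intro i k h
  have hi := i.2
  have : N - (k : ℕ) = (N - (i : ℕ)) + 1 := by omega
  rw [this, pow_succ]
  field_simp
  ring

theorem ketbra_dicke (i : Fin (N + 1)) : ketbra (dicke N i) = diagonal (Pi.single i (1 : ℂ)) := by
  ext a b
  simp only [ketbra, dicke, vecMulVec_apply, Pi.star_apply, diagonal_apply, Pi.single_apply]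
  split_ifs <;> simp_all

/-- The normalization is a geometric series. Unlike the closed form, `geo` also makes sense at `s² =
1`, which the Gibbs state at `β = 0` needs. -/
theorem diagState_eq_geo {s : ℝ} (hs : s ^ 2 ≠ 1) : diagState N s = geo N s := by
  have hsum : ∑ k : Fin (N + 1), s ^ (2 * (N - (k : ℕ))) = (1 - s ^ (2 * N + 2)) / (1 - s ^ 2) := by
    rw [Fin.sum_univ_eq_sum_range (fun k => s ^ (2 * (N - k))) (N + 1)]
    have := Finset.sum_range_reflect (fun k => (s ^ 2) ^ k) (N + 1)
    rw [geom_sum_eq hs] at this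
    simp only [← pow_mul, Nat.add_sub_cancel] at this
    rw [this, ← neg_sub (s ^ 2), ← neg_sub (s ^ _), neg_div_neg_eq]
    rfl
  rw [diagState, geo, hsum]
  ext a b
  rw [Matrix.sum_apply, Finset.sum_eq_single a]
  · rw [Matrix.smul_apply, ketbra_dicke, diagonal_apply, diagonal_apply, Pi.single_eq_same]
    split_ifs
    · rw [smul_eq_mul, mul_one, div_div_eq_mul_div, mul_div_assoc]
    · simp
  · intro i _ hi
    rw [Matrix.smul_apply, ketbra_dicke, diagonal_apply, Pi.single_eq_of_ne hi.symm]
    simp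
  · simp

/-- `-βm = -βj + β(j - m)`; the factor `e^{-βj}` is common to all levels and cancels on normalizing.
-/
theorem gibbs_eq_geo (N : ℕ) (β : ℝ) : gibbs N β = geo N (Real.exp (β / 2)) := by
  have e : NormedSpace.exp ((-(β : ℂ)) • Jz N) = ((Real.exp (-(β * N / 2)) : ℝ) : ℂ) •
      diagonal fun i : Fin (N + 1) => ((Real.exp (β / 2) ^ (2 * (N - (i : ℕ))) : ℝ) : ℂ) := by
    rw [Jz, ← diagonal_smul, exp_diagonal, ← diagonal_smul]
    congr 1
    ext i
    have hi : (i : ℕ) ≤ N := Nat.lt_succ_iff.1 i.2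
    rw [Pi.coe_exp, ← exp_eq_exp_ℂ, Pi.smul_apply, Pi.smul_apply, smul_eq_mul, smul_eq_mul,
      ← ofReal_neg, ← ofReal_mul, ← ofReal_exp, ← ofReal_mul, ← Real.exp_nat_mul, ← Real.exp_add,
      mag]
    push_cast [Nat.cast_sub hi]
    congr 1
    ring
  have hc : ((Real.exp (-(β * N / 2)) : ℝ) : ℂ) ≠ 0 := ofReal_ne_zero.2 (Real.exp_pos _).ne'
  rw [gibbs, e, trace_smul, smul_eq_mul, smul_smul, _root_.mul_inv_rev, inv_mul_cancel_right₀ hc,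
    trace_diagonal, geo, ← diagonal_smul]
  congr 1
  ext i
  rw [Pi.smul_apply, smul_eq_mul, ofReal_div, ofReal_sum]
  exact (div_eq_inv_mul _ _).symm

theorem ketbra_isState {ψ : Fin (N + 1) → ℂ} (hψ : star ψ ⬝ᵥ ψ = 1) : IsState (ketbra ψ) := by
  refine ⟨posSemidef_vecMulVec_self_star ψ, ?_⟩
  rw [ketbra, trace_vecMulVec, dotProduct_comm, hψ]

theorem ketbra_mul_self {ψ : Fin (N + 1) → ℂ} (hψ : star ψ ⬝ᵥ ψ = 1) :
    ketbra ψ * ketbra ψ = ketbra ψ := by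
  rw [ketbra, vecMulVec_mul_vecMulVec, hψ]; simp

theorem mul_ketbra (A : Op N) (ψ : Fin (N + 1) → ℂ) : A * ketbra ψ * Aᴴ = ketbra (A *ᵥ ψ) := by
  rw [ketbra, ketbra, mul_vecMulVec, vecMulVec_mul, star_mulVec]

/-- Eigenvectors of `c X + i d Y` attain equality. -/
theorem Setting.saturates_of_eigenvector {X Y Z : Op N} {ψ : Fin (N + 1) → ℂ}
    (h : Setting (ketbra ψ) X Y Z) (hψ : star ψ ⬝ᵥ ψ = 1) {c d : ℝ} (hcd : c ≠ 0 ∨ d ≠ 0) {z : ℂ}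
    (hz : ((c : ℂ) • X + (I * d) • Y) *ᵥ ψ = z • ψ) : Saturates (ketbra ψ) X Y Z := by
  set B := ketbra ψ with hB
  have hBB : B * B = B := ketbra_mul_self hψ
  have hs : sqrtOp B = B := sqrtOp_eq h.state.1 hBB
  have hBh : Bᴴ = B := h.state.1.isHermitian
  have hK : ((c : ℂ) • X + (I * d) • Y) * B = z • B := by
    rw [hB, ketbra, mul_vecMulVec, hz, smul_vecMulVec]
  have htr : (c : ℂ) * (B * X).trace + (I * d) * (B * Y).trace = z := by
    have := congrArg trace hK
    rw [trace_mul_comm, mul_add, trace_add, mul_smul_comm, mul_smul_comm, trace_smul, trace_smul,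
      trace_smul, h.state.2] at this
    simpa using this
  have hK0 : (c : ℂ) • (centred B X * B) + (I * d) • (centred B Y * B) = 0 := by
    rw [← htr, add_mul, smul_mul_assoc, smul_mul_assoc] at hK
    simp only [centred, sub_mul, smul_mul_assoc, one_mul]
    linear_combination (norm := module) hK
  have hXh := centred_isHermitian h.state.1.isHermitian h.hX
  have hYh := centred_isHermitian h.state.1.isHermitian h.hY
  -- The adjoint of the eigenvalue equation; sums and differences of the two express commutators
  -- through anticommutators.
  have hK1 : (c : ℂ) • (B * centred B X) - (I * d) • (B * centred B Y) = 0 := by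
    have := congrArg conjTranspose hK0
    rw [conjTranspose_add, conjTranspose_smul, conjTranspose_smul, conjTranspose_mul,
      conjTranspose_mul, hXh.eq, hYh.eq, hBh, conjTranspose_zero] at this
    simpa [sub_eq_add_neg] using this
  have hI : I * I = -1 := I_mul_I
  have hcomm : ∀ A : Op N, centred B A * B = 0 → B * centred B A = 0 → Commute B A := by
    intro A h1 h2
    rw [← skewPart_eq_zero, ← skewPart_centred B, skewPart_eq_zero, Commute, SemiconjBy, h1, h2]
  -- If `c` or `d` vanishes, the state commutes with one observable and equality is `0 = 0`.
  by_cases hc : c = 0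
  · subst hc
    have hd : (I * (d : ℂ)) ≠ 0 := mul_ne_zero I_ne_zero (by simpa using hcd)
    simp only [ofReal_zero, zero_smul, zero_add, zero_sub, neg_eq_zero, smul_eq_zero, hd,
      false_or] at hK0 hK1
    exact h.saturates_of_commute (Or.inr (hcomm Y hK0 hK1))
  by_cases hd : d = 0
  · subst hd
    have hc' : (c : ℂ) ≠ 0 := by exact_mod_cast hc
    simp only [ofReal_zero, mul_zero, zero_smul, add_zero, sub_zero, smul_eq_zero, hc',
      false_or] at hK0 hK1
    exact h.saturates_of_commute (Or.inl (hcomm X hK0 hK1))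
  have hc' : (c : ℂ) ≠ 0 := by exact_mod_cast hc
  have hd' : (d : ℂ) ≠ 0 := by exact_mod_cast hd
  refine h.saturates_of_eq_smul (a := d / c) (b := -(c / d)) ?_ ?_
  · rw [← skewPart_centred B, hs, skewPart_eq_smul_iff]
    apply smul_right_injective _ hc'
    simp only [smul_smul, smul_sub, smul_add, ofReal_div]
    rw [show (c : ℂ) * (I * (d / c)) = I * d by field_simp]
    linear_combination (norm := module) hK1 - hK0
  · rw [← skewPart_centred B, hs, skewPart_eq_smul_iff]
    apply smul_right_injective _ (mul_ne_zero I_ne_zero hd')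
    simp only [smul_smul, smul_sub, smul_add, ofReal_div, ofReal_neg]
    rw [show I * (d : ℂ) * (I * -(c / d)) = c by field_simp; simp]
    linear_combination (norm := module) -hK1 - hK0

end Equality

/-! ### The structure of the states attaining equality -/

section Structure

open Complex
variable {N : ℕ}

/-- The two proportionalities are linear in `BX₀`, `X₀B`, `BY₀`, `Y₀B`. Whether they can be solved
for `BX₀` and `BY₀` is decided by `1 + ab`. -/
theorem Setting.exists_structure {ρ X Y Z : Op N} (h : Setting ρ X Y Z) (hs : Saturates ρ X Y Z)
    (hne : U ρ X * U ρ Y ≠ 0) : ∃ a : ℝ, a ≠ 0 ∧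
      sqrtOp ρ * X - X * sqrtOp ρ =
        (I * a) • (sqrtOp ρ * centred ρ Y + centred ρ Y * sqrtOp ρ) ∧
      (Commute (sqrtOp ρ) Z ∨ ∃ z : ℂ, (X + (I * a) • Y) * sqrtOp ρ = z • sqrtOp ρ) := by
  obtain ⟨a, b, ha, hb, h1, h2⟩ := h.exists_eq_smul hs hne
  refine ⟨a, ha, skewPart_eq_smul_iff.1 h1, ?_⟩
  rw [← skewPart_centred ρ, skewPart_eq_smul_iff] at h1 h2
  have hXY : centred ρ X * centred ρ Y - centred ρ Y * centred ρ X = I • Z := by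
    rw [← h.comm]; simp only [centred, mul_sub, sub_mul, smul_mul_assoc, mul_smul_comm, mul_one,
      one_mul]
    module
  set B := sqrtOp ρ
  set x := (ρ * X).trace
  set y := (ρ * Y).trace
  have hX : X = centred ρ X + x • 1 := by simp [centred, x]
  have hY : Y = centred ρ Y + y • 1 := by simp [centred, y]
  set X₀ := centred ρ X
  set Y₀ := centred ρ Y
  have hI : I * I = -1 := I_mul_I
  by_cases hab : a * b = -1
  · right
    have hab' : (a : ℂ) * b = -1 := by exact_mod_cast hab
    have h3 : X₀ * B + (I * a) • (Y₀ * B) = 0 := by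
      apply smul_right_injective _ (two_ne_zero (α := ℂ))
      simp only [smul_zero]
      have hh : (I * a) * (I * b) = 1 := by linear_combination (a * b) * hI - hab'
      linear_combination (norm := module) -h1 - (I * a) • h2 + hh • (-(X₀ * B) - B * X₀)
    refine ⟨x + I * a * y, ?_⟩
    rw [hX, hY]
    simp only [add_mul, smul_add, smul_mul_assoc, one_mul]
    linear_combination (norm := module) h3
  · left
    have hab' : (1 : ℂ) + a * b ≠ 0 := by
      intro h0
      apply hab
      have : (1 : ℝ) + a * b = 0 := by exact_mod_cast h0
      linarith
    -- Moving `B` to the right acts linearly on the span of `X₀` and `Y₀`.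
    have hX : ((1 : ℂ) + a * b) • (B * X₀) = ((1 - a * b : ℂ) • X₀ + (2 * I * a) • Y₀) * B := by
      rw [add_mul, smul_mul_assoc, smul_mul_assoc]
      linear_combination (norm := module) h1 + (I * a) • h2 + (a * b * hI) • (X₀ * B + B * X₀)
    have hY : ((1 : ℂ) + a * b) • (B * Y₀) = ((1 - a * b : ℂ) • Y₀ + (2 * I * b) • X₀) * B := by
      rw [add_mul, smul_mul_assoc, smul_mul_assoc]
      linear_combination (norm := module) h2 + (I * b) • h1 + (a * b * hI) • (Y₀ * B + B * Y₀)
    have key : ∀ {c : ℂ} {P Q P' Q' : Op N}, c • (B * P) = P' * B → c • (B * Q) = Q' * B →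
        (c * c) • (B * (P * Q)) = P' * Q' * B := by
      intro c P Q P' Q' hP hQ
      rw [mul_smul, ← mul_assoc, ← smul_mul_assoc, hP, mul_assoc P', ← mul_smul_comm, mul_assoc,
        hQ]
    have e1 := key hX hY
    have e2 := key hY hX
    have e3 : B * (I • Z) = (I • Z) * B := by
      rw [← hXY]
      apply smul_right_injective _ (mul_ne_zero hab' hab')
      simp only [mul_sub, smul_sub, e1, e2]
      simp only [add_mul, mul_add, sub_mul, smul_mul_assoc, mul_smul_comm, smul_add, smul_smul]
      -- The linear action has determinant `((1 - ab)² + 4ab)/(1 + ab)² = 1`, so the commutator is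
      -- left unchanged.
      linear_combination (norm := module) (-4 * a * b * hI) • (X₀ * Y₀ * B - Y₀ * X₀ * B)
    have e4 : I • (B * Z) = I • (Z * B) := by simpa using e3
    exact smul_right_injective _ I_ne_zero e4

end Structure

/-! ### Solving the equality equations for the coordinate axes -/

section Classification

open Complex
open scoped ComplexOrder
variable {N : ℕ}

theorem geo_zero : geo N 0 = ketbra (dicke N (Fin.last N)) := by
  rw [ketbra_dicke, geo]
  have h : ∀ i : Fin (N + 1), (0 : ℝ) ^ (2 * (N - (i : ℕ))) = if i = Fin.last N then 1 else 0 := by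
    intro i
    split_ifs with h
    · simp [h]
    · have := i.2
      have h' : (i : ℕ) ≠ N := fun h' => h (Fin.ext h')
      exact zero_pow (by omega)
  simp only [h]
  congr 1
  ext i
  by_cases hi : i = Fin.last N <;> simp [hi]

theorem diagClass_of_commute {ρ : Op N} (hρ : IsState ρ) {a : ℝ} (ha : a ≠ 0)
    (he : sqrtOp ρ * Jx N - Jx N * sqrtOp ρ =
      (I * a) • (sqrtOp ρ * centred ρ (Jy N) + centred ρ (Jy N) * sqrtOp ρ))
    (hc : Commute (sqrtOp ρ) (Jz N)) : DiagClass ρ := by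
  have hpos := sqrtOp_posSemidef ρ
  have hBB := sqrtOp_mul_self hρ.1
  set B := sqrtOp ρ
  have hd : ∀ i j, i ≠ j → B i j = 0 := by
    intro i j hij
    have h := congrFun₂ hc.eq i j
    rw [Jz, mul_diagonal, diagonal_mul, mul_comm, ← sub_eq_zero, ← sub_mul, mul_eq_zero] at h
    refine h.resolve_left fun h0 => hij ?_
    rw [sub_eq_zero, ofReal_inj, mag, mag] at h0
    have : (i : ℝ) = (j : ℝ) := by linarith
    exact Fin.ext (by exact_mod_cast this)
  obtain ⟨b, hb⟩ : ∃ b : Fin (N + 1) → ℝ, B = diagonal fun i => (b i : ℂ) := by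
    refine ⟨fun i => (B i i).re, ?_⟩
    ext i j
    rw [diagonal_apply]
    split_ifs with h
    · rw [← h]
      exact ((conj_eq_iff_re.1 (hpos.isHermitian.apply i i))).symm
    · exact hd i j h
  have hb0 : ∀ i, 0 ≤ b i := by
    rw [hb, posSemidef_diagonal_iff] at hpos
    intro i
    exact_mod_cast hpos i
  -- Read off the entry just below the diagonal, where the scalar from centring contributes nothing.
  have hab : ∀ i k : Fin (N + 1), (i : ℕ) = k + 1 → (1 - a) * b i = (1 + a) * b k := by
    intro i k hik
    have hne : i ≠ k := by rintro rfl; omega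
    have h := congrFun₂ he i k
    rw [centred, hb] at h
    simp only [Matrix.sub_apply, Matrix.smul_apply, Matrix.add_apply, mul_sub, sub_mul,
      diagonal_mul, mul_diagonal, Jx, Jy_eq, Jplus_apply, Jminus_apply, hik, if_true,
      smul_mul_assoc, mul_smul_comm, one_mul, mul_one, diagonal_apply_ne _ hne, smul_eq_mul] at h
    rw [if_neg (by omega)] at h
    have hI : I * I = -1 := I_mul_I
    have hk : k.val < N := by have := i.2; omega
    have hl : (ladder N k : ℂ) ≠ 0 := ofReal_ne_zero.2 (ladder_pos hk).ne'
    have h2 : (ladder N k : ℂ) * ((1 - a) * b i - (1 + a) * b k) = 0 := by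
      linear_combination 2 * h - (a * (b i + b k) * ladder N k) * hI
    have h3 := (mul_eq_zero.1 h2).resolve_left hl
    have h4 : (1 - a) * b i - (1 + a) * b k = 0 := by exact_mod_cast h3
    linarith
  have hρd : ρ = diagonal fun i => ((b i ^ 2 : ℝ) : ℂ) := by
    rw [← hBB, hb, diagonal_mul_diagonal]
    congr 1
    ext i
    push_cast
    ring
  have htr : ∑ i, b i ^ 2 = 1 := by
    have := hρ.2
    rw [hρd, trace_diagonal] at this
    exact_mod_cast this
  -- Here the ratio `(1 - a)/(1 + a)` is infinite: only the lowest level is occupied, a limit of the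
  -- family not contained in it.
  by_cases ha1 : a = -1
  · right
    have hz : ∀ i : Fin (N + 1), i ≠ 0 → b i = 0 := by
      intro i hi
      obtain ⟨k, rfl⟩ := Fin.exists_succ_eq.2 hi
      have := hab k.succ k.castSucc (by simp)
      rw [ha1] at this
      linarith
    rw [Finset.sum_eq_single 0 (fun i _ hi => by rw [hz i hi]; simp) (by simp)] at htr
    rw [hρd, ketbra_dicke]
    congr 1
    ext i
    by_cases hi : i = 0
    · rw [hi, htr]; simp
    · rw [hz i hi, Pi.single_eq_of_ne hi]; simp
  · left
    have ha1' : 1 + a ≠ 0 := fun h => ha1 (by linarith)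
    have hs : ((1 - a) / (1 + a)) ^ 2 ≠ 1 := by
      rw [div_pow, Ne, div_eq_one_iff_eq (pow_ne_zero 2 ha1')]
      intro h
      apply ha
      linarith
    refine ⟨(1 - a) / (1 + a), hs, ?_⟩
    rw [diagState_eq_geo hs]
    set s := (1 - a) / (1 + a) with hsd
    have hstep : ∀ k : Fin N, b k.castSucc = s * b k.succ := by
      intro k
      have := hab k.succ k.castSucc (by simp)
      rw [hsd]
      field_simp
      linarith
    have hpow : ∀ i : Fin (N + 1), b i = s ^ (N - (i : ℕ)) * b (Fin.last N) := by
      intro i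
      induction i using Fin.reverseInduction with
      | last => simp
      | cast k ih =>
        rw [hstep, ih, Fin.val_succ, Fin.val_castSucc, ← mul_assoc, ← pow_succ']
        congr 2
        have := k.2
        omega
    have hpow2 : ∀ i : Fin (N + 1), b i ^ 2 = s ^ (2 * (N - (i : ℕ))) * b (Fin.last N) ^ 2 := by
      intro i
      rw [hpow, mul_pow, ← pow_mul, mul_comm 2]
    rw [Finset.sum_congr rfl fun i _ => hpow2 i, ← Finset.sum_mul] at htr
    rw [hρd, geo]
    congr 1
    ext i
    rw [hpow2, eq_div_of_mul_eq (geo_sum_pos N s).ne' ((mul_comm _ _).trans htr), mul_one_div]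

/-- The vector `φ` divided by its norm. -/
noncomputable def normed (φ : Fin (N + 1) → ℂ) : Fin (N + 1) → ℂ :=
  (((Real.sqrt (star φ ⬝ᵥ φ).re)⁻¹ : ℝ) : ℂ) • φ

theorem exists_star_dotProduct_self (φ : Fin (N + 1) → ℂ) :
    ∃ r : ℝ, 0 ≤ r ∧ star φ ⬝ᵥ φ = r := by
  obtain ⟨h1, h2⟩ := Complex.le_def.1 (dotProduct_star_self_nonneg φ)
  exact ⟨(star φ ⬝ᵥ φ).re, h1, Complex.ext (by simp) (by simpa using h2.symm)⟩

theorem ketbra_smul (c : ℂ) (φ : Fin (N + 1) → ℂ) :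
    ketbra (c • φ) = (c * star c) • ketbra φ := by
  rw [ketbra, ketbra, star_smul, smul_vecMulVec, vecMulVec_smul, smul_smul]

theorem ketbra_normed (φ : Fin (N + 1) → ℂ) :
    ketbra (normed φ) = (star φ ⬝ᵥ φ)⁻¹ • ketbra φ := by
  obtain ⟨r, hr, h⟩ := exists_star_dotProduct_self φ
  rw [normed, ketbra_smul, h, ← ofReal_inv, ofReal_re]
  congr 1
  rw [RCLike.star_def, conj_ofReal, ← ofReal_mul, ← mul_inv, Real.mul_self_sqrt hr]

theorem normed_unit {φ : Fin (N + 1) → ℂ} (hφ : φ ≠ 0) : star (normed φ) ⬝ᵥ normed φ = 1 := by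
  obtain ⟨r, hr, h⟩ := exists_star_dotProduct_self φ
  have h0 : r ≠ 0 := by
    rintro rfl
    exact hφ (dotProduct_star_self_eq_zero.1 (by rw [h, ofReal_zero]))
  rw [normed, star_smul, smul_dotProduct, dotProduct_smul, smul_smul, h, RCLike.star_def,
    conj_ofReal, ofReal_re, smul_eq_mul, ← ofReal_mul, ← ofReal_mul, ← mul_inv,
    Real.mul_self_sqrt hr, inv_mul_cancel₀ h0, ofReal_one]

/-- Only one row of `TB` survives, so `B = S(TB)` has rank one with column space spanned by one
column of `S`; the trace fixes the scale. -/
theorem eq_ketbra_normed {B S T : Op N} (hST : S * T = 1) (htr : (B * Bᴴ).trace = 1)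
    {i₀ : Fin (N + 1)} (h : ∀ i, i ≠ i₀ → ∀ j, (T * B) i j = 0) :
    B * Bᴴ = ketbra (normed (S *ᵥ dicke N i₀)) := by
  have h1 : T * B = vecMulVec (dicke N i₀) ((T * B) i₀) := by
    ext i j
    rw [vecMulVec_apply, dicke]
    by_cases hi : i = i₀
    · rw [hi, Pi.single_eq_same, one_mul]
    · rw [h i hi, Pi.single_eq_of_ne hi, zero_mul]
  have h2 : B = vecMulVec (S *ᵥ dicke N i₀) ((T * B) i₀) := by
    rw [← mul_vecMulVec, ← h1, ← mul_assoc, hST, one_mul]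
  generalize (T * B) i₀ = r at h2
  set φ := S *ᵥ dicke N i₀
  have h3 : B * Bᴴ = (r ⬝ᵥ star r) • ketbra φ := by
    rw [h2, conjTranspose_vecMulVec, vecMulVec_mul_vecMulVec, ketbra, vecMulVec_smul]
  rw [h3, trace_smul, ketbra, trace_vecMulVec, smul_eq_mul, dotProduct_comm φ] at htr
  rw [ketbra_normed, h3, eq_inv_of_mul_eq_one_left htr]

/-- In the basis given by the columns of `S`, `K` becomes `J_z`, whose spectrum is simple. A nonzero
`B` with all columns in one eigenspace thus occupies one row. -/
theorem eq_ketbra_of_eigen {B S T K : Op N} (hST : S * T = 1) (hKS : K * S = S * Jz N)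
    (htr : (B * Bᴴ).trace = 1) {z : ℂ} (hz : K * B = z • B) :
    ∃ i, B * Bᴴ = ketbra (normed (S *ᵥ dicke N i)) := by
  have hTS : T * S = 1 := mul_eq_one_comm.1 hST
  have hTK : T * K = Jz N * T := by
    calc T * K = T * (K * S) * T := by rw [mul_assoc, mul_assoc, hST, mul_one]
      _ = Jz N * T := by rw [hKS, ← mul_assoc, hTS, one_mul]
  have h1 : Jz N * (T * B) = z • (T * B) := by
    rw [← mul_assoc, ← hTK, mul_assoc, hz, mul_smul_comm]
  have h2 : ∀ i j, (T * B) i j ≠ 0 → ((mag N i : ℝ) : ℂ) = z := by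
    intro i j hij
    have := congrFun₂ h1 i j
    rw [Jz, diagonal_mul, Matrix.smul_apply, smul_eq_mul] at this
    exact mul_right_cancel₀ hij this
  have h3 : T * B ≠ 0 := by
    intro h0
    have : B = 0 := by rw [← one_mul B, ← hST, mul_assoc, h0, mul_zero]
    rw [this] at htr
    simp at htr
  obtain ⟨i₀, j₀, h4⟩ : ∃ i j, (T * B) i j ≠ 0 := by
    by_contra! h5
    exact h3 (by ext i j; exact h5 i j)
  refine ⟨i₀, eq_ketbra_normed hST htr fun i hi j => ?_⟩
  by_contra h5
  have h6 := (h2 i j h5).trans (h2 i₀ j₀ h4).symm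
  rw [ofReal_inj, mag, mag] at h6
  have : (i : ℝ) = (i₀ : ℝ) := by linarith
  exact hi (Fin.ext (by exact_mod_cast this))

theorem normed_dicke (i : Fin (N + 1)) : normed (dicke N i) = dicke N i := by
  have : star (dicke N i) ⬝ᵥ dicke N i = 1 := by
    simp [dicke]
  rw [normed, this]
  simp

/-- `J₊` is nilpotent with one-dimensional kernel: for `z = 0` read off the kernel, for `z ≠ 0` the
entries vanish successively from the bottom up. -/
theorem eq_zero_of_Jplus_eigen {v : Fin (N + 1) → ℂ} {z : ℂ} (h : Jplus N *ᵥ v = z • v)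
    (i : Fin (N + 1)) (hi : i ≠ Fin.last N) : v i = 0 := by
  have hs : ∀ k : Fin N, (ladder N k : ℂ) * v k.castSucc = z * v k.succ := by
    intro k
    have := congrFun h k.succ
    rw [mulVec, dotProduct, Finset.sum_eq_single k.castSucc] at this
    · simpa [Jplus_apply] using this
    · intro l _ hl
      rw [Jplus_apply, if_neg, zero_mul]
      intro h'
      exact hl (Fin.ext (by simpa using h'.symm))
    · simp
  have hl : ∀ k : Fin N, (ladder N k : ℂ) ≠ 0 := fun k => ofReal_ne_zero.2 (ladder_pos k.2).ne'
  by_cases hz : z = 0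
  · obtain ⟨k, rfl⟩ := Fin.exists_castSucc_eq.2 hi
    simpa [hz, hl k] using hs k
  · have h0 : v 0 = 0 := by
      have := congrFun h 0
      rw [mulVec, dotProduct, Finset.sum_eq_zero] at this
      · simpa [hz] using this.symm
      · intro l _
        simp [Jplus_apply]
    clear hi
    induction i using Fin.induction with
    | zero => exact h0
    | succ k ih =>
      have := hs k
      rw [ih, mul_zero] at this
      exact (mul_eq_zero.1 this.symm).resolve_left hz

theorem eq_zero_of_Jminus_eigen {v : Fin (N + 1) → ℂ} {z : ℂ} (h : Jminus N *ᵥ v = z • v)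
    (i : Fin (N + 1)) (hi : i ≠ 0) : v i = 0 := by
  have hs : ∀ k : Fin N, (ladder N k : ℂ) * v k.succ = z * v k.castSucc := by
    intro k
    have := congrFun h k.castSucc
    rw [mulVec, dotProduct, Finset.sum_eq_single k.succ] at this
    · simpa [Jminus_apply] using this
    · intro l _ hl
      rw [Jminus_apply, if_neg, zero_mul]
      intro h'
      exact hl (Fin.ext (by simpa using h'))
    · simp
  have hl : ∀ k : Fin N, (ladder N k : ℂ) ≠ 0 := fun k => ofReal_ne_zero.2 (ladder_pos k.2).ne'
  by_cases hz : z = 0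
  · obtain ⟨k, rfl⟩ := Fin.exists_succ_eq.2 hi
    simpa [hz, hl k] using hs k
  · have h0 : v (Fin.last N) = 0 := by
      have := congrFun h (Fin.last N)
      rw [mulVec, dotProduct, Finset.sum_eq_zero] at this
      · simpa [hz] using this.symm
      · intro l _
        rw [Jminus_apply, if_neg, zero_mul]
        have := l.2
        simp only [Fin.val_last]
        omega
    clear hi
    induction i using Fin.reverseInduction with
    | last => exact h0
    | cast k ih =>
      have := hs k
      rw [ih, mul_zero] at this
      exact (mul_eq_zero.1 this.symm).resolve_left hz

/-! ### Squeezed states -/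

theorem Jx_add_Jy : Jx N + I • Jy N = Jplus N := by
  rw [Jy_eq, Jx, smul_smul, mul_neg, ← mul_div_assoc, I_mul_I]
  module

theorem Jx_sub_Jy : Jx N - I • Jy N = Jminus N := by
  rw [Jy_eq, Jx, smul_smul, mul_neg, ← mul_div_assoc, I_mul_I]
  module

theorem Jz_Jy_comm : Jz N * Jy N - Jy N * Jz N = -(I • Jx N) := by
  rw [← Jy_Jz_comm, neg_sub]

theorem Jy_Jx_comm : Jy N * Jx N - Jx N * Jy N = -(I • Jz N) := by
  rw [← Jx_Jy_comm, neg_sub]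

/-- The operator that takes `|j,m⟩` to the unnormalized squeezed state. -/
noncomputable def squeezer (N : ℕ) (β : ℝ) : Op N :=
  NormedSpace.exp ((β : ℂ) • Jz N) * NormedSpace.exp ((-(I * (Real.pi : ℂ) / 2)) • Jy N)

/-- `exp(-iθ J_z)`. -/
noncomputable def zRot (N : ℕ) (θ : ℝ) : Op N := NormedSpace.exp ((-(I * (θ : ℂ))) • Jz N)

theorem zRot_mul_conjTranspose (θ : ℝ) : zRot N θ * (zRot N θ)ᴴ = 1 :=
  exp_smul_mul_conjTranspose Jz_isHermitian θ

theorem squeezedVec_eq (β : ℝ) (i : Fin (N + 1)) :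
    squeezedVec N β i = squeezer N β *ᵥ dicke N i := by
  rw [squeezedVec, squeezer, mulVec_mulVec]

theorem squeezed_eq (β : ℝ) (i : Fin (N + 1)) :
    squeezed N β i = normed (squeezer N β *ᵥ dicke N i) := by
  rw [← squeezedVec_eq]; rfl

theorem exists_squeezer_mul_eq_one (N : ℕ) (β : ℝ) : ∃ T, squeezer N β * T = 1 := by
  refine ⟨NormedSpace.exp (-((-(I * (Real.pi : ℂ) / 2)) • Jy N)) *
    NormedSpace.exp (-((β : ℂ) • Jz N)), ?_⟩
  rw [squeezer, mul_assoc, ← mul_assoc _ _ (NormedSpace.exp (-((β : ℂ) • Jz N))),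
    exp_mul_exp_neg, one_mul, exp_mul_exp_neg]

/-- The quarter turn about `y` carries `J_z` to `J_x`, and `e^{βJ_z}` is a rotation about `z` by the
imaginary angle `iβ`, turning cosine and sine into `cosh` and `i sinh`. -/
theorem squeezer_mul_Jz (β : ℝ) : ((Real.cosh β : ℂ) • Jx N + (I * Real.sinh β) • Jy N) *
    squeezer N β = squeezer N β * Jz N := by
  have h1 := exp_mul_rotate (Jz_Jx_comm (N := N)) Jz_Jy_comm (β * I)
  rw [cos_mul_I, sin_mul_I, show -(I * (β * I)) = (β : ℂ) by linear_combination -β * I_mul_I] at h1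
  have h2 := exp_mul_rotate (Jy_Jz_comm (N := N)) Jy_Jx_comm ((Real.pi / 2 : ℝ) : ℂ)
  rw [← ofReal_cos, ← ofReal_sin, Real.cos_pi_div_two, Real.sin_pi_div_two, ofReal_zero, ofReal_one,
    zero_smul, one_smul, zero_add, ofReal_div, ofReal_ofNat, ← mul_div_assoc] at h2
  rw [squeezer, mul_assoc _ _ (Jz N), h2, ← mul_assoc, ← mul_assoc, h1, ofReal_cosh, ofReal_sinh,
    mul_comm I]

theorem zRot_mul_Jx : zRot N (Real.pi / 2) * Jx N = Jy N * zRot N (Real.pi / 2) := by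
  have h := exp_mul_rotate (Jz_Jx_comm (N := N)) Jz_Jy_comm ((Real.pi / 2 : ℝ) : ℂ)
  rwa [← ofReal_cos, ← ofReal_sin, Real.cos_pi_div_two, Real.sin_pi_div_two, ofReal_zero,
    ofReal_one, zero_smul, one_smul, zero_add] at h

theorem zRot_mul_Jy : zRot N (Real.pi / 2) * Jy N = -Jx N * zRot N (Real.pi / 2) := by
  have h := exp_mul_rotate (A := Jz N) (P := Jy N) (Q := -Jx N)
    (by rw [Jz_Jy_comm, smul_neg]) (by rw [← Jz_Jx_comm]; noncomm_ring)
    ((Real.pi / 2 : ℝ) : ℂ)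
  rwa [← ofReal_cos, ← ofReal_sin, Real.cos_pi_div_two, Real.sin_pi_div_two, ofReal_zero,
    ofReal_one, zero_smul, one_smul, zero_add] at h

theorem zRot_zero : zRot N 0 = 1 := by simp [zRot]

theorem star_mulVec_dotProduct {V : Op N} (hV : Vᴴ * V = 1) (φ : Fin (N + 1) → ℂ) :
    star (V *ᵥ φ) ⬝ᵥ (V *ᵥ φ) = star φ ⬝ᵥ φ := by
  rw [star_mulVec, dotProduct_mulVec, vecMul_vecMul, hV, vecMul_one]

theorem normed_mulVec {V : Op N} (hV : Vᴴ * V = 1) (φ : Fin (N + 1) → ℂ) :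
    normed (V *ᵥ φ) = V *ᵥ normed φ := by
  rw [normed, star_mulVec_dotProduct hV, normed, mulVec_smul]

theorem squeezed_unit (β : ℝ) (i : Fin (N + 1)) :
    star (squeezed N β i) ⬝ᵥ squeezed N β i = 1 := by
  rw [squeezed_eq]
  refine normed_unit fun h => ?_
  obtain ⟨T, hT⟩ := exists_squeezer_mul_eq_one N β
  have h1 := congrArg (T *ᵥ ·) h
  simp only [mulVec_mulVec, mul_eq_one_comm.1 hT, one_mulVec, mulVec_zero] at h1
  have := congrFun h1 i
  simp [dicke] at this

theorem squeezed_eigen (β : ℝ) (i : Fin (N + 1)) :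
    ((Real.cosh β : ℂ) • Jx N + (I * Real.sinh β) • Jy N) *ᵥ squeezed N β i =
      (mag N i : ℂ) • squeezed N β i := by
  have hz : Jz N *ᵥ dicke N i = (mag N i : ℂ) • dicke N i := by
    ext k
    rw [Jz, mulVec_diagonal, dicke, Pi.smul_apply, smul_eq_mul]
    by_cases h : k = i
    · rw [h]
    · rw [Pi.single_eq_of_ne h, mul_zero, mul_zero]
  rw [squeezed_eq, normed, mulVec_smul, mulVec_mulVec, squeezer_mul_Jz, ← mulVec_mulVec, hz,
    mulVec_smul, smul_comm]

theorem zRot_squeezed_unit (β : ℝ) (i : Fin (N + 1)) :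
    star (zRot N (Real.pi / 2) *ᵥ squeezed N β i) ⬝ᵥ
      (zRot N (Real.pi / 2) *ᵥ squeezed N β i) = 1 := by
  rw [star_mulVec_dotProduct (mul_eq_one_comm.1 (zRot_mul_conjTranspose _)), squeezed_unit]

/-- The quarter turn produces `cosh β J_y - i sinh β J_x`; the factor `-i` restores the shape `cJ_x
+ idJ_y` with real coefficients. -/
theorem zRot_squeezed_eigen (β : ℝ) (i : Fin (N + 1)) :
    (((-Real.sinh β : ℝ) : ℂ) • Jx N + (I * ((-Real.cosh β : ℝ) : ℂ)) • Jy N) *ᵥ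
        (zRot N (Real.pi / 2) *ᵥ squeezed N β i) =
      (-I * mag N i) • (zRot N (Real.pi / 2) *ᵥ squeezed N β i) := by
  have h := congrArg (zRot N (Real.pi / 2) *ᵥ ·) (squeezed_eigen β i)
  simp only [add_mulVec, smul_mulVec, mulVec_add, mulVec_smul, mulVec_mulVec, zRot_mul_Jx,
    zRot_mul_Jy] at h
  rw [mul_smul (-I) (mag N i : ℂ), ← h, add_mulVec, smul_mulVec, smul_mulVec]
  simp only [mulVec_mulVec, neg_mul, neg_mulVec, ofReal_neg]
  linear_combination (norm := module) (-(Real.sinh β : ℂ) * I_mul_I) •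
    ((Jx N * zRot N (Real.pi / 2)) *ᵥ squeezed N β i)

theorem squeezed_saturates (β : ℝ) (i : Fin (N + 1)) :
    Saturates (ketbra (squeezed N β i)) (Jx N) (Jy N) (Jz N) :=
  (setting_axes (ketbra_isState (squeezed_unit β i))).saturates_of_eigenvector (squeezed_unit β i)
    (Or.inl (Real.cosh_pos β).ne') (squeezed_eigen β i)

theorem zRot_squeezed_saturates (β : ℝ) (i : Fin (N + 1)) :
    Saturates (ketbra (zRot N (Real.pi / 2) *ᵥ squeezed N β i)) (Jx N) (Jy N) (Jz N) := by
  have hu := zRot_squeezed_unit β i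
  exact (setting_axes (ketbra_isState hu)).saturates_of_eigenvector hu
    (Or.inr (neg_ne_zero.2 (Real.cosh_pos β).ne')) (zRot_squeezed_eigen β i)

theorem saturates_of_class {ρ : Op N} (h : DiagClass ρ ∨ SqueezedClass ρ) :
    Saturates ρ (Jx N) (Jy N) (Jz N) := by
  rcases h with (⟨s, hs, rfl⟩ | rfl) | ⟨θ, β, i, hθ, rfl⟩
  · rw [diagState_eq_geo hs]
    exact geo_saturates N s
  · have h1 : star (dicke N 0) ⬝ᵥ dicke N 0 = 1 := by simp [dicke]
    refine (setting_axes (ketbra_isState h1)).saturates_of_eigenvector h1 (c := 1) (d := -1)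
      (z := 0) (Or.inl one_ne_zero) ?_
    have e : ((1 : ℝ) : ℂ) • Jx N + (I * ((-1 : ℝ) : ℂ)) • Jy N = Jminus N := by
      rw [← Jx_sub_Jy]
      push_cast
      module
    rw [e, zero_smul]
    ext i
    simp [dicke, Jminus_apply]
  · change Saturates (ketbra (zRot N θ *ᵥ squeezed N β i)) _ _ _
    rcases hθ with rfl | rfl
    · rw [zRot_zero, one_mulVec]
      exact squeezed_saturates β i
    · exact zRot_squeezed_saturates β i

theorem class_of_saturates {ρ : Op N} (hρ : IsState ρ) (hs : Saturates ρ (Jx N) (Jy N) (Jz N))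
    (hne : U ρ (Jx N) * U ρ (Jy N) ≠ 0) : DiagClass ρ ∨ SqueezedClass ρ := by
  obtain ⟨a, ha, he, hc | ⟨z, hz⟩⟩ := (setting_axes hρ).exists_structure hs hne
  · exact Or.inl (diagClass_of_commute hρ ha he hc)
  have hB : sqrtOp ρ * (sqrtOp ρ)ᴴ = ρ := by
    rw [(sqrtOp_isHermitian ρ).eq, sqrtOp_mul_self hρ.1]
  have htr : (sqrtOp ρ * (sqrtOp ρ)ᴴ).trace = 1 := by rw [hB, hρ.2]
  set B := sqrtOp ρ
  have hcol : ∀ {K : Op N} {w : ℂ}, K * B = w • B → ∀ j, K *ᵥ (fun i => B i j) = w • fun i => B i j :=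
    fun h j => funext fun i => congrFun₂ h i j
  -- For `|a| < 1` put `a = tanh β`; for `|a| > 1` put `1/a = tanh β` and exchange the axes by a
  -- quarter turn; for `|a| = 1` the operator is `J₊` or `J₋`.
  rcases lt_trichotomy |a| 1 with h1 | h1 | h1
  · right
    have ha' : a ∈ Set.Ioo (-1) 1 := abs_lt.1 h1
    set β := Real.artanh a with hβ
    have ht : (a : ℂ) * Real.cosh β = Real.sinh β := by
      rw [← ofReal_mul, ofReal_inj, ← Real.tanh_artanh ha', Real.tanh_eq_sinh_div_cosh]
      exact div_mul_cancel₀ _ (Real.cosh_pos _).ne'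
    obtain ⟨T, hT⟩ := exists_squeezer_mul_eq_one N β
    obtain ⟨i, hi⟩ := eq_ketbra_of_eigen hT (squeezer_mul_Jz β) htr (z := Real.cosh β * z) (by
      rw [← ht, mul_smul _ z B, ← hz, ← smul_mul_assoc, smul_add, smul_smul]
      congr 3
      ring)
    refine ⟨0, β, i, Or.inl rfl, ?_⟩
    change ρ = ketbra (zRot N 0 *ᵥ squeezed N β i)
    rw [zRot_zero, one_mulVec, squeezed_eq, ← hi, hB]
  · left
    rcases eq_or_eq_neg_of_abs_eq h1 with rfl | rfl
    · left
      rw [ofReal_one, mul_one, Jx_add_Jy] at hz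
      have h := eq_ketbra_normed (S := 1) (T := 1) (mul_one 1) htr (i₀ := Fin.last N)
        (fun i hi j => by
          rw [one_mul]
          exact eq_zero_of_Jplus_eigen (hcol hz j) i hi)
      refine ⟨0, by simp, ?_⟩
      rw [one_mulVec, normed_dicke, hB] at h
      rw [diagState_eq_geo (by simp), geo_zero, h]
    · right
      rw [ofReal_neg, ofReal_one, mul_neg_one, neg_smul, ← sub_eq_add_neg, Jx_sub_Jy] at hz
      have h := eq_ketbra_normed (S := 1) (T := 1) (mul_one 1) htr (i₀ := 0)
        (fun i hi j => by
          rw [one_mul]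
          exact eq_zero_of_Jminus_eigen (hcol hz j) i hi)
      rwa [one_mulVec, normed_dicke, hB] at h
  · right
    have ha' : a⁻¹ ∈ Set.Ioo (-1) 1 := by
      rw [Set.mem_Ioo, ← abs_lt, abs_inv]
      exact inv_lt_one_of_one_lt₀ h1
    set β := Real.artanh a⁻¹ with hβ
    have ht : (Real.cosh β : ℂ) = a * Real.sinh β := by
      have ht' : a⁻¹ * Real.cosh β = Real.sinh β := by
        rw [← Real.tanh_artanh ha', Real.tanh_eq_sinh_div_cosh]
        exact div_mul_cancel₀ _ (Real.cosh_pos _).ne'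
      rw [← ofReal_mul, ofReal_inj, ← ht', mul_inv_cancel_left₀ ha]
    obtain ⟨T, hT⟩ := exists_squeezer_mul_eq_one N β
    have hW := zRot_mul_conjTranspose (N := N) (Real.pi / 2)
    set W := zRot N (Real.pi / 2) with hWd
    have hK : ((Real.cosh β : ℂ) • Jy N - (I * Real.sinh β) • Jx N) * (W * squeezer N β) =
        W * squeezer N β * Jz N := by
      rw [mul_assoc W, ← squeezer_mul_Jz, ← mul_assoc, ← mul_assoc, mul_add, mul_smul_comm,
        mul_smul_comm, zRot_mul_Jx, zRot_mul_Jy, sub_mul, smul_mul_assoc, smul_mul_assoc, neg_mul,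
        smul_neg, ← sub_eq_add_neg]
    obtain ⟨i, hi⟩ := eq_ketbra_of_eigen (S := W * squeezer N β) (T := T * Wᴴ) (by
        rw [mul_assoc, ← mul_assoc _ T, hT, one_mul, hW]) hK htr
      (z := -(I * Real.sinh β) * z) (by
        rw [ht, mul_smul _ z B, ← hz, ← smul_mul_assoc, smul_add, smul_smul]
        congr 1
        linear_combination (norm := module) (a * Real.sinh β * I_mul_I) • Jy N)
    refine ⟨Real.pi / 2, β, i, Or.inr rfl, ?_⟩
    change ρ = ketbra (W *ᵥ squeezed N β i)
    rw [squeezed_eq, ← normed_mulVec (mul_eq_one_comm.1 hW), mulVec_mulVec, ← hi, hB]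

end Classification

/-! ### General directions -/

section Frames

open Complex
open scoped ComplexOrder
variable {N : ℕ}

theorem conj_mul_conj {V : Op N} (hV : Vᴴ * V = 1) (A B : Op N) :
    V * A * Vᴴ * (V * B * Vᴴ) = V * (A * B) * Vᴴ := by
  calc V * A * Vᴴ * (V * B * Vᴴ) = V * A * (Vᴴ * V) * B * Vᴴ := by simp only [mul_assoc]
    _ = V * (A * B) * Vᴴ := by rw [hV, mul_one]; simp only [mul_assoc]

theorem trace_conj {V : Op N} (hV : Vᴴ * V = 1) (A : Op N) : (V * A * Vᴴ).trace = A.trace := by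
  rw [mul_assoc, trace_mul_comm, mul_assoc, hV, mul_one]

theorem IsState.conj {V ρ : Op N} (hV : Vᴴ * V = 1) (hρ : IsState ρ) : IsState (V * ρ * Vᴴ) :=
  ⟨hρ.1.mul_mul_conjTranspose_same V, by rw [trace_conj hV, hρ.2]⟩

theorem U_conj {V ρ : Op N} (hV : Vᴴ * V = 1) (hρ : ρ.PosSemidef) (X : Op N) :
    U (V * ρ * Vᴴ) (V * X * Vᴴ) = U ρ X := by
  have hc : centred (V * ρ * Vᴴ) (V * X * Vᴴ) = V * centred ρ X * Vᴴ := by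
    rw [centred, centred, conj_mul_conj hV, trace_conj hV, mul_sub, sub_mul, mul_smul_comm, mul_one,
      smul_mul_assoc, mul_eq_one_comm.1 hV]
  rw [U, U, skewInfo, skewInfo, antiInfo, antiInfo, hc, sqrtOp_conj hV hρ]
  simp only [conj_mul_conj hV, ← mul_add, ← add_mul, sq, trace_conj hV]

theorem saturates_conj {V ρ X Y Z : Op N} (hV : Vᴴ * V = 1) (hρ : ρ.PosSemidef) :
    Saturates (V * ρ * Vᴴ) (V * X * Vᴴ) (V * Y * Vᴴ) (V * Z * Vᴴ) ↔ Saturates ρ X Y Z := by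
  rw [Saturates, Saturates, U_conj hV hρ, U_conj hV hρ, conj_mul_conj hV, trace_conj hV]

theorem EqUpToSign.U_eq {A B : Op N} (h : EqUpToSign A B) (ρ : Op N) : U ρ A = U ρ B := by
  rcases h with rfl | rfl
  · rfl
  · have hc : centred ρ (-B) = -centred ρ B := by
      rw [centred, centred, mul_neg, trace_neg, neg_smul]; abel
    rw [U, U, skewInfo, skewInfo, antiInfo, antiInfo, hc]
    simp only [mul_neg, neg_mul, neg_neg, ← neg_add, neg_sq]

theorem EqUpToSign.norm_trace_eq {A B : Op N} (h : EqUpToSign A B) (ρ : Op N) :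
    ‖(ρ * A).trace‖ = ‖(ρ * B).trace‖ := by
  rcases h with rfl | rfl
  · rfl
  · rw [mul_neg, trace_neg, norm_neg]

theorem EqUpToSign.neg {A B : Op N} (h : EqUpToSign A B) : EqUpToSign (-A) B := by
  rcases h with rfl | rfl
  · exact Or.inr rfl
  · exact Or.inl (neg_neg B)

/-- Signs and order of the axes are immaterial: `U` is even in the observable, the trace enters
through its norm, and the product is symmetric. -/
theorem Aligned.saturates {R ρ : Op N} {n : Fin 3 → EuclideanSpace ℝ (Fin 3)} (hR : Rᴴ * R = 1)
    (hA : Aligned R n) (hρ : ρ.PosSemidef) (h : Saturates ρ (Jx N) (Jy N) (Jz N)) :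
    Saturates (R * ρ * Rᴴ) (J N (n 0)) (J N (n 1)) (J N (n 2)) := by
  rw [← saturates_conj hR hρ] at h
  obtain ⟨hz, ⟨hx, hy⟩ | ⟨hx, hy⟩⟩ := hA
  · rwa [Saturates, hx.U_eq, hy.U_eq, hz.norm_trace_eq] at h
  · rwa [Saturates, hx.U_eq, hy.U_eq, hz.norm_trace_eq, mul_comm (U _ _)] at h

theorem diagState_isState {s : ℝ} (hs : s ^ 2 ≠ 1) : IsState (diagState N s) := by
  rw [diagState_eq_geo hs]; exact geo_isState N s

theorem diagState_saturates {s : ℝ} (hs : s ^ 2 ≠ 1) :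
    Saturates (diagState N s) (Jx N) (Jy N) (Jz N) :=
  saturates_of_class (Or.inl (Or.inl ⟨s, hs, rfl⟩))

theorem saturates_of_rotClass {ρ : Op N} {n : Fin 3 → EuclideanSpace ℝ (Fin 3)}
    (h : RotDiagClass n ρ ∨ RotSqueezedClass n ρ) :
    Saturates ρ (J N (n 0)) (J N (n 1)) (J N (n 2)) := by
  rcases h with ⟨R, s, hR, hA, hs, rfl⟩ | ⟨R, β, i, hR, hA, rfl⟩
  · exact hA.saturates hR.conjTranspose_mul (diagState_isState hs).1 (diagState_saturates hs)
  · rw [← mul_ketbra]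
    exact hA.saturates hR.conjTranspose_mul (ketbra_isState (squeezed_unit β i)).1
      (squeezed_saturates β i)

/-- Applied to products of rotation operators, this supplies one exponential acting the same way on
all operators, possibly differing from the product itself. -/
theorem exists_rotation_conj_eq {V : Op N} (hV : Vᴴ * V = 1) {a b : Fin 3 → ℝ}
    (ha : a ⬝ᵥ a = 1) (hb : b ⬝ᵥ b = 1) (hab : a ⬝ᵥ b = 0) (hx : V * Jx N * Vᴴ = ang N a)
    (hy : V * Jy N * Vᴴ = ang N b) :
    ∃ R : Op N, IsRotation R ∧ ∀ A, R * A * Rᴴ = V * A * Vᴴ := by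
  obtain ⟨R, hR, h0, h1⟩ := exists_rotation (N := N) ha hb hab
  exact ⟨R, hR, conj_eq_conj hR.conjTranspose_mul hV (h0.trans hx.symm) (h1.trans hy.symm)⟩

theorem exists_flip (N : ℕ) : ∃ F : Op N, IsRotation F ∧ F * Jx N * Fᴴ = Jx N ∧
    F * Jy N * Fᴴ = -Jy N ∧ F * Jz N * Fᴴ = -Jz N := by
  -- A half turn about the `x`-axis.
  obtain ⟨F, hF, hx, hy⟩ := exists_rotation (N := N) (a := Pi.single 0 1) (b := -Pi.single 1 1)
    (by simp) (by simp) (by simp)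
  have hz := conj_Jz hF.conjTranspose_mul hx hy
  refine ⟨F, hF, by rw [hx, ang_x], by rw [hy, ang_neg, ang_y], ?_⟩
  rw [hz, ← ang_z, ← ang_neg]
  congr 1
  ext i
  fin_cases i <;> simp [cross_apply]

/-- Since `F` reverses `J_z`, it sends `|j,j⟩` to an eigenvector of eigenvalue `-j`, which is
`|j,-j⟩` up to a phase. -/
theorem flip_ketbra {F : Op N} (hF : Fᴴ * F = 1) (hz : F * Jz N * Fᴴ = -Jz N) :
    F * ketbra (dicke N (Fin.last N)) * Fᴴ = ketbra (dicke N 0) := by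
  have h1 : star (dicke N (Fin.last N)) ⬝ᵥ dicke N (Fin.last N) = 1 := by simp [dicke]
  have hst := ketbra_isState h1
  set P := ketbra (dicke N (Fin.last N)) with hP
  have hB : (F * P) * (F * P)ᴴ = F * P * Fᴴ := by
    rw [conjTranspose_mul, hst.1.isHermitian.eq, mul_assoc, ← mul_assoc P, ketbra_mul_self h1,
      mul_assoc]
  have hJ : Jz N * P = ((N / 2 : ℝ) : ℂ) • P := by
    rw [hP, ketbra_dicke, Jz, diagonal_mul_diagonal, ← diagonal_smul]
    congr 1
    ext i
    by_cases hi : i = Fin.last N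
    · rw [hi, mag]; simp; ring
    · simp [hi]
  have hFJ : Jz N * F = -(F * Jz N) := by
    have h2 := congrArg (· * F) hz
    simp only [mul_assoc, hF, mul_one, neg_mul] at h2
    rw [h2, neg_neg]
  have hE : Jz N * (F * P) = -(((N / 2 : ℝ) : ℂ) • (F * P)) := by
    rw [← mul_assoc, hFJ, neg_mul, mul_assoc, hJ, mul_smul_comm]
  have h := eq_ketbra_normed (B := F * P) (S := 1) (T := 1) (mul_one 1)
    (by rw [hB, trace_conj hF, hst.2]) (i₀ := 0) (fun i hi j => by
      rw [one_mul]
      have h3 := congrFun₂ hE i j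
      rw [Jz, diagonal_mul, Matrix.neg_apply, Matrix.smul_apply, smul_eq_mul, mag] at h3
      have h4 : ((i : ℕ) : ℂ) * (F * P) i j = 0 := by
        push_cast at h3
        linear_combination h3
      refine (mul_eq_zero.1 h4).resolve_left fun h5 => hi ?_
      exact_mod_cast h5)
  rwa [hB, one_mulVec, normed_dicke] at h

theorem diagState_zero : diagState N 0 = ketbra (dicke N (Fin.last N)) := by
  rw [diagState_eq_geo (by simp), geo_zero]

theorem rotClass_of_saturates {ρ : Op N} (hρ : IsState ρ) {n : Fin 3 → EuclideanSpace ℝ (Fin 3)}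
    (hn : Orthonormal ℝ n) {R : Op N} (hR : IsRotation R) (hx : R * Jx N * Rᴴ = J N (n 0))
    (hy : R * Jy N * Rᴴ = J N (n 1)) (hz : EqUpToSign (R * Jz N * Rᴴ) (J N (n 2)))
    (hs : Saturates ρ (J N (n 0)) (J N (n 1)) (J N (n 2)))
    (hne : U ρ (J N (n 0)) * U ρ (J N (n 1)) ≠ 0) : RotDiagClass n ρ ∨ RotSqueezedClass n ρ := by
  have hd := orthonormal_iff_dotProduct.1 hn
  have hR1 := hR.conjTranspose_mul
  have hR2 := hR.mul_conjTranspose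
  have hA : Aligned R n := ⟨hz, Or.inl ⟨Or.inl hx, Or.inl hy⟩⟩
  -- Pull the state back to the coordinate axes.
  obtain ⟨σ, hσ, rfl⟩ : ∃ σ, IsState σ ∧ R * σ * Rᴴ = ρ := by
    refine ⟨Rᴴ * ρ * R, ?_, ?_⟩
    · have := IsState.conj (V := Rᴴ) (by rwa [conjTranspose_conjTranspose]) hρ
      rwa [conjTranspose_conjTranspose] at this
    · calc R * (Rᴴ * ρ * R) * Rᴴ = (R * Rᴴ) * ρ * (R * Rᴴ) := by simp only [mul_assoc]
        _ = ρ := by rw [hR2, one_mul, mul_one]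
  rw [Saturates, ← hz.norm_trace_eq, ← hx, ← hy] at hs
  rw [← hx, ← hy, U_conj hR1 hσ.1, U_conj hR1 hσ.1] at hne
  have hcl := class_of_saturates hσ ((saturates_conj hR1 hσ.1).1 hs) hne
  have comp : ∀ {V : Op N}, Vᴴ * V = 1 → (R * V)ᴴ * (R * V) = 1 ∧
      ∀ A, R * V * A * (R * V)ᴴ = R * (V * A * Vᴴ) * Rᴴ := by
    intro V hV
    rw [conjTranspose_mul]
    refine ⟨?_, fun A => by simp only [mul_assoc]⟩
    rw [mul_assoc, ← mul_assoc Rᴴ, hR1, one_mul, hV]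
  rw [J_eq_ang] at hx hy
  rcases hcl with (⟨s, hs1, rfl⟩ | rfl) | ⟨θ, β, i, rfl | rfl, rfl⟩
  · exact Or.inl ⟨R, s, hR, hA, hs1, rfl⟩
  · left
    -- In the frame flipped about its first axis, `|j,-j⟩` becomes `D_0`.
    obtain ⟨F, hF, hFx, hFy, hFz⟩ := exists_flip N
    obtain ⟨h1, h2⟩ := comp hF.conjTranspose_mul
    obtain ⟨S, hS, hSA⟩ := exists_rotation_conj_eq h1 (a := (n 0).ofLp) (b := -(n 1).ofLp)
      (by simp [hd]) (by simp [hd]) (by simp [hd]) (by rw [h2, hFx, hx])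
      (by rw [h2, hFy, mul_neg, neg_mul, hy, ang_neg])
    refine ⟨S, 0, hS, ⟨?_, Or.inl ⟨Or.inl ?_, Or.inr ?_⟩⟩, by simp, ?_⟩
    · rw [hSA, h2, hFz, mul_neg, neg_mul]
      exact hz.neg
    · rw [hSA, h2, hFx, hx, J_eq_ang]
    · rw [hSA, h2, hFy, mul_neg, neg_mul, hy, J_eq_ang]
    · rw [hSA, h2, diagState_zero, flip_ketbra hF.conjTranspose_mul hFz]
  · right
    refine ⟨R, β, i, hR, hA, ?_⟩
    change R * ketbra (zRot N 0 *ᵥ squeezed N β i) * Rᴴ = _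
    rw [zRot_zero, one_mulVec, mul_ketbra]
  · right
    change RotSqueezedClass n (R * ketbra (zRot N (Real.pi / 2) *ᵥ squeezed N β i) * Rᴴ)
    -- The quarter turn is absorbed into the rotation, which now carries `x`, `y` to `n 1`, `-n 0`;
    -- this is why alignment allows the swapped order.
    have hW := zRot_mul_conjTranspose (N := N) (Real.pi / 2)
    obtain ⟨h1, h2⟩ := comp (mul_eq_one_comm.1 hW)
    have hWx := mul_mul_conjTranspose_eq hW zRot_mul_Jx
    have hWy := mul_mul_conjTranspose_eq hW zRot_mul_Jy
    have hWz : zRot N (Real.pi / 2) * Jz N * (zRot N (Real.pi / 2))ᴴ = Jz N :=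
      mul_mul_conjTranspose_eq hW (exp_mul_eq_of_semiconj (by simp))
    obtain ⟨S, hS, hSA⟩ := exists_rotation_conj_eq h1 (a := (n 1).ofLp) (b := -(n 0).ofLp)
      (by simp [hd]) (by simp [hd]) (by simp [hd]) (by rw [h2, hWx, hy])
      (by rw [h2, hWy, mul_neg, neg_mul, hx, ang_neg])
    refine ⟨S, β, i, hS, ⟨?_, Or.inr ⟨Or.inl ?_, Or.inr ?_⟩⟩, ?_⟩
    · rw [hSA, h2, hWz]
      exact hz
    · rw [hSA, h2, hWx, hy, J_eq_ang]
    · rw [hSA, h2, hWy, mul_neg, neg_mul, hx, J_eq_ang]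
    · rw [← mul_ketbra S, hSA, h2, mul_ketbra (zRot N _)]

/-- The sign is the orientation of the frame: `n 2` equals plus or minus the cross product of the
first two vectors. -/
theorem exists_rotation_of_orthonormal {n : Fin 3 → EuclideanSpace ℝ (Fin 3)}
    (hn : Orthonormal ℝ n) : ∃ R : Op N, IsRotation R ∧ R * Jx N * Rᴴ = J N (n 0) ∧
      R * Jy N * Rᴴ = J N (n 1) ∧ EqUpToSign (R * Jz N * Rᴴ) (J N (n 2)) := by
  have hd := orthonormal_iff_dotProduct.1 hn
  obtain ⟨R, hR, hx, hy⟩ := exists_rotation (N := N) (a := (n 0).ofLp) (b := (n 1).ofLp)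
    (by simp [hd]) (by simp [hd]) (by simp [hd])
  refine ⟨R, hR, hx, hy, ?_⟩
  rw [conj_Jz hR.conjTranspose_mul hx hy, J_eq_ang]
  set c := crossProduct (n 0).ofLp (n 1).ofLp with hc
  have hcc : c ⬝ᵥ c = 1 := by rw [hc, cross_dot_cross, hd, hd, hd]; simp
  have h2 := frame_expand (w := (n 0).ofLp) (u := (n 1).ofLp) (by simp [hd]) (by simp [hd])
    (by simp [hd]) (n 2).ofLp
  rw [hd, hd, ← hc] at h2
  simp only [show (0 : Fin 3) ≠ 2 by decide, show (1 : Fin 3) ≠ 2 by decide, if_false, zero_smul,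
    zero_add] at h2
  have h3 := hd 2 2
  rw [if_pos rfl, h2, smul_dotProduct, dotProduct_smul, hcc] at h3
  have h4 : (c ⬝ᵥ (n 2).ofLp) = 1 ∨ (c ⬝ᵥ (n 2).ofLp) = -1 := by
    apply mul_self_eq_one_iff.1
    simpa using h3
  rcases h4 with h4 | h4
  · left; rw [h2, h4, one_smul]
  · right; rw [h2, h4, neg_one_smul, ang_neg, neg_neg]

theorem setting_frame {ρ : Op N} (hρ : IsState ρ) (n : Fin 3 → EuclideanSpace ℝ (Fin 3)) :
    Setting ρ (J N (n 0)) (J N (n 1)) (ang N (crossProduct (n 0).ofLp (n 1).ofLp)) :=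
  ⟨hρ, ang_isHermitian _, ang_isHermitian _, ang_comm _ _⟩

theorem IsRotation.exists_frame {R : Op N} (hR : IsRotation R) :
    ∃ n : Fin 3 → EuclideanSpace ℝ (Fin 3), Orthonormal ℝ n ∧ R * Jx N * Rᴴ = J N (n 0) ∧
      R * Jy N * Rᴴ = J N (n 1) ∧ R * Jz N * Rᴴ = J N (n 2) := by
  obtain ⟨t, w, hw, rfl⟩ := hR.exists_ang
  refine ⟨fun i => WithLp.toLp 2 (rot w t (Pi.single i 1)), orthonormal_iff_dotProduct.2 ?_,
    ?_, ?_, ?_⟩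
  · intro i j
    rw [rot_dotProduct hw]
    simp [Pi.single_apply, eq_comm]
  · rw [← ang_x, exp_ang_conj hw]; rfl
  · rw [← ang_y, exp_ang_conj hw]; rfl
  · rw [← ang_z, exp_ang_conj hw]; rfl

end Frames

/-! ### Spin 1/2 -/

section Half

open Complex

theorem half_mulVec (c d : ℝ) (ψ : Fin 2 → ℂ) :
    ((c : ℂ) • Jx 1 + (I * d) • Jy 1) *ᵥ ψ =
      ![((c : ℂ) - d) / 2 * ψ 1, ((c : ℂ) + d) / 2 * ψ 0] := by
  have hI : I * I = -1 := I_mul_I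
  have hl : ladder 1 0 = 1 := by simp [ladder]
  ext i
  fin_cases i
  · simp [mulVec, dotProduct, Fin.sum_univ_two, Jx, Jy_eq, Jplus_apply, Jminus_apply, hl]
    left
    linear_combination (d / 2 : ℂ) * hI
  · simp [mulVec, dotProduct, Fin.sum_univ_two, Jx, Jy_eq, Jplus_apply, Jminus_apply, hl]
    left
    linear_combination -(d / 2 : ℂ) * hI

theorem half_saturates {ρ : Op 1} (hρ : IsState ρ) (h : HalfDiagClass ρ ∨ HalfPureClass ρ) :
    Saturates ρ (Jx 1) (Jy 1) (Jz 1) := by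
  rcases h with ⟨s, rfl⟩ | ⟨t, ε, h1, h2, hε, rfl⟩
  · have hs : 0 < 2 * (s ^ 2 + 1) := by positivity
    set b : Fin 2 → ℝ := ![|s - 1| / Real.sqrt (2 * (s ^ 2 + 1)),
      |s + 1| / Real.sqrt (2 * (s ^ 2 + 1))] with hb
    have e : !![(((s - 1) ^ 2 / (2 * (s ^ 2 + 1)) : ℝ) : ℂ), 0;
        0, (((s + 1) ^ 2 / (2 * (s ^ 2 + 1)) : ℝ) : ℂ)] =
        diagonal fun i => ((b i ^ 2 : ℝ) : ℂ) := by
      have e0 : b 0 ^ 2 = (s - 1) ^ 2 / (2 * (s ^ 2 + 1)) := by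
        rw [hb, cons_val_zero, div_pow, sq_abs, Real.sq_sqrt hs.le]
      have e1 : b 1 ^ 2 = (s + 1) ^ 2 / (2 * (s ^ 2 + 1)) := by
        rw [hb, cons_val_one, cons_val_zero, div_pow, sq_abs, Real.sq_sqrt hs.le]
      rw [← e0, ← e1]
      ext i j
      fin_cases i <;> fin_cases j <;> simp
    rw [e] at hρ ⊢
    have hb0 : ∀ i, 0 ≤ b i := by
      intro i
      fin_cases i <;> simp only [hb] <;> simp <;> positivity
    have hpos : 0 < b 1 + b 0 := by
      have : 0 < |s + 1| + |s - 1| := by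
        rcases le_total s 0 with h | h
        · have := abs_pos.2 (show s - 1 ≠ 0 by linarith)
          positivity
        · have := abs_pos.2 (show s + 1 ≠ 0 by linarith)
          positivity
      have e : b 1 + b 0 = (|s + 1| + |s - 1|) / Real.sqrt (2 * (s ^ 2 + 1)) := by
        simp [hb, add_div]
      rw [e]
      exact div_pos this (Real.sqrt_pos.2 hs)
    -- With two levels there is one recurrence, and this `a` solves it for any two weights.
    refine saturates_diagonal (N := 1) hb0 (a := (b 1 - b 0) / (b 1 + b 0)) hρ ?_
    intro i k hik
    obtain ⟨rfl, rfl⟩ : i = 1 ∧ k = 0 := by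
      constructor <;> ext <;> simp <;> omega
    field_simp
    ring
  · have h1' : 0 ≤ (1 + t) / 2 := by linarith
    have h2' : 0 ≤ (1 - t) / 2 := by linarith
    have hp : ((Real.sqrt ((1 + t) / 2) : ℝ) : ℂ) ^ 2 = (1 + t) / 2 := by
      rw [← ofReal_pow, Real.sq_sqrt h1']; push_cast; ring
    have hq : ((Real.sqrt ((1 - t) / 2) : ℝ) : ℂ) ^ 2 = (1 - t) / 2 := by
      rw [← ofReal_pow, Real.sq_sqrt h2']; push_cast; ring
    set p : ℂ := ((Real.sqrt ((1 + t) / 2) : ℝ) : ℂ)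
    set q : ℂ := ((Real.sqrt ((1 - t) / 2) : ℝ) : ℂ)
    have hu := hρ.2
    rw [ketbra, trace_vecMulVec, dotProduct_comm] at hu
    have hε' : ε ^ 2 = 1 ∨ ε ^ 2 = -1 := by
      have h : (ε ^ 2 - 1) * (ε ^ 2 + 1) = 0 := by linear_combination hε
      exact (mul_eq_zero.1 h).imp sub_eq_zero.1 eq_neg_of_add_eq_zero_left
    rcases hε' with hε' | hε'
    -- Real `ε` gives an eigenvector of `J_x - itJ_y`; imaginary `ε`, below, one of `-tJ_x + iJ_y`.
    · refine (setting_axes hρ).saturates_of_eigenvector hu (c := 1) (d := -t) (z := p * q * ε)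
        (Or.inl one_ne_zero) ?_
      rw [half_mulVec]
      ext i
      fin_cases i
      · simp
        linear_combination -q * hp - p ^ 2 * q * hε'
      · simp
        linear_combination -ε * p * hq
    · refine (setting_axes hρ).saturates_of_eigenvector hu (c := -t) (d := 1) (z := p * q * ε)
        (Or.inr one_ne_zero) ?_
      rw [half_mulVec]
      ext i
      fin_cases i
      · simp
        linear_combination q * hp - p ^ 2 * q * hε'
      · simp
        linear_combination -ε * p * hq

/-- Eliminating `z` gives `(c + d)ψ₀² = (c - d)ψ₁²` with nonzero real coefficients, so `(ψ₀/ψ₁)²` is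
real and the relative phase `ε` is a fourth root of unity. The modulus gives `t`. -/
theorem halfPureClass_of_eigen {ψ : Fin 2 → ℂ} (hu : star ψ ⬝ᵥ ψ = 1) {c d : ℝ}
    (hcd : c ^ 2 - d ^ 2 ≠ 0) {z : ℂ} (hz : ((c : ℂ) • Jx 1 + (I * d) • Jy 1) *ᵥ ψ = z • ψ) :
    HalfPureClass (ketbra (N := 1) ψ) := by
  have hm : c - d ≠ 0 := fun h => hcd (by linear_combination (c + d) * h)
  have hp : c + d ≠ 0 := fun h => hcd (by linear_combination (c - d) * h)
  have hpC : (c : ℂ) + d ≠ 0 := by exact_mod_cast hp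
  rw [half_mulVec] at hz
  have z0 : ((c : ℂ) - d) / 2 * ψ 1 = z * ψ 0 := congrFun hz 0
  have z1 : ((c : ℂ) + d) / 2 * ψ 0 = z * ψ 1 := congrFun hz 1
  have hsq : ((c : ℂ) + d) * ψ 0 ^ 2 = (c - d) * ψ 1 ^ 2 := by
    linear_combination 2 * ψ 0 * z1 - 2 * ψ 1 * z0
  have hunit : ‖ψ 0‖ ^ 2 + ‖ψ 1‖ ^ 2 = 1 := by
    have h : ((‖ψ 0‖ ^ 2 + ‖ψ 1‖ ^ 2 : ℝ) : ℂ) = 1 := by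
      rw [← hu]
      simp [dotProduct, Fin.sum_univ_two, Complex.conj_mul']
    exact_mod_cast h
  have hn : |c + d| * ‖ψ 0‖ ^ 2 = |c - d| * ‖ψ 1‖ ^ 2 := by
    have := congrArg norm hsq
    rwa [norm_mul, norm_mul, norm_pow, norm_pow, ← ofReal_add, ← ofReal_sub, norm_real, norm_real,
      Real.norm_eq_abs, Real.norm_eq_abs] at this
  have h0 : ψ 0 ≠ 0 := by
    intro h
    rw [h, norm_zero] at hn hunit
    have : ‖ψ 1‖ ^ 2 = 1 := by linarith
    rw [this] at hn
    exact hm (abs_eq_zero.1 (by linarith))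
  have h1 : ψ 1 ≠ 0 := by
    intro h
    rw [h, norm_zero] at hn hunit
    have : ‖ψ 0‖ ^ 2 = 1 := by linarith
    rw [this] at hn
    exact hp (abs_eq_zero.1 (by linarith))
  have n0 : (‖ψ 0‖ : ℂ) ≠ 0 := by simpa using h0
  have n1 : (‖ψ 1‖ : ℂ) ≠ 0 := by simpa using h1
  refine ⟨1 - 2 * ‖ψ 1‖ ^ 2, (ψ 0 * ‖ψ 1‖) / (ψ 1 * ‖ψ 0‖), ?_, ?_, ?_, ?_⟩
  · nlinarith [sq_nonneg ‖ψ 0‖]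
  · nlinarith [sq_nonneg ‖ψ 1‖]
  · have a4 : (((c + d) * ‖ψ 0‖ ^ 2 : ℝ) : ℂ) ^ 2 = (((c - d) * ‖ψ 1‖ ^ 2 : ℝ) : ℂ) ^ 2 := by
      rw [← ofReal_pow, ← ofReal_pow, ofReal_inj, ← sq_abs, abs_mul,
        abs_of_nonneg (sq_nonneg ‖ψ 0‖),
        hn, mul_pow, sq_abs, mul_pow]
    push_cast at a4
    rw [div_pow, div_eq_one_iff_eq (pow_ne_zero 4 (mul_ne_zero h1 n0))]
    have hmC : (c : ℂ) - d ≠ 0 := by exact_mod_cast hm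
    apply mul_left_cancel₀ (pow_ne_zero 2 (mul_ne_zero hpC hmC))
    have hsq2 : (((c : ℂ) + d) * ψ 0 ^ 2) ^ 2 = ((c - d) * ψ 1 ^ 2) ^ 2 := by rw [hsq]
    linear_combination ((c - d : ℂ) * ‖ψ 1‖ ^ 2) ^ 2 * hsq2 - ((c - d : ℂ) * ψ 1 ^ 2) ^ 2 * a4
  · rw [show (1 + (1 - 2 * ‖ψ 1‖ ^ 2)) / 2 = ‖ψ 0‖ ^ 2 by linarith,
      show (1 - (1 - 2 * ‖ψ 1‖ ^ 2)) / 2 = ‖ψ 1‖ ^ 2 by ring, Real.sqrt_sq (norm_nonneg _),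
      Real.sqrt_sq (norm_nonneg _)]
    have e : ψ = (ψ 1 / ‖ψ 1‖) •
        ![(ψ 0 * ‖ψ 1‖) / (ψ 1 * ‖ψ 0‖) * ((‖ψ 0‖ : ℝ) : ℂ), ((‖ψ 1‖ : ℝ) : ℂ)] := by
      ext i
      fin_cases i
      · simp; field_simp
      · simp; field_simp
    have hph : ψ 1 / ‖ψ 1‖ * star (ψ 1 / ‖ψ 1‖) = 1 := by
      rw [RCLike.star_def, Complex.mul_conj', norm_div, norm_real, norm_norm,
        div_self (norm_ne_zero_iff.2 h1)]
      simp
    nth_rewrite 1 [e]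
    rw [ketbra_smul, hph, one_smul]

/-- The two parametrizations of the weights differ by the Möbius map `s ↦ (1 + s)/(1 - s)`. -/
theorem halfDiagClass_geo {s : ℝ} (hs : s ≠ 1) : HalfDiagClass (geo 1 s) := by
  have h1 : 1 - s ≠ 0 := sub_ne_zero.2 hs.symm
  have h2 : s ^ 2 + 1 ≠ 0 := by positivity
  have h3 : ((1 + s) / (1 - s)) ^ 2 + 1 ≠ 0 := by positivity
  have e0 : (((1 + s) / (1 - s)) - 1) ^ 2 / (2 * (((1 + s) / (1 - s)) ^ 2 + 1)) =
      s ^ 2 / (s ^ 2 + 1) := by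
    rw [div_eq_div_iff (mul_ne_zero two_ne_zero h3) h2]
    field_simp
    ring
  have e1 : (((1 + s) / (1 - s)) + 1) ^ 2 / (2 * (((1 + s) / (1 - s)) ^ 2 + 1)) =
      1 / (s ^ 2 + 1) := by
    rw [div_eq_div_iff (mul_ne_zero two_ne_zero h3) h2]
    field_simp
    ring
  refine ⟨(1 + s) / (1 - s), ?_⟩
  rw [e0, e1, geo]
  ext i j
  fin_cases i <;> fin_cases j <;> simp [Fin.sum_univ_two]

theorem half_class_of_saturates {ρ : Op 1} (hρ : IsState ρ)
    (hs : Saturates ρ (Jx 1) (Jy 1) (Jz 1)) (hne : U ρ (Jx 1) * U ρ (Jy 1) ≠ 0) :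
    HalfDiagClass ρ ∨ HalfPureClass ρ := by
  rcases class_of_saturates hρ hs hne with (⟨s, h, rfl⟩ | rfl) | ⟨θ, β, i, hθ, rfl⟩
  · left
    rw [diagState_eq_geo h]
    exact halfDiagClass_geo (by rintro rfl; simp at h)
  · left
    -- The value of that Möbius map at infinity.
    refine ⟨-1, ?_⟩
    rw [ketbra_dicke]
    ext i j
    fin_cases i <;> fin_cases j <;> norm_num
  · right
    change HalfPureClass (ketbra (zRot 1 θ *ᵥ squeezed 1 β i))
    have hcs := Real.cosh_sq β
    rcases hθ with rfl | rfl
    · rw [zRot_zero, one_mulVec]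
      refine halfPureClass_of_eigen (squeezed_unit β i) ?_ (squeezed_eigen β i)
      rw [hcs]; norm_num
    · refine halfPureClass_of_eigen (zRot_squeezed_unit β i) ?_ (zRot_squeezed_eigen β i)
      rw [neg_sq, neg_sq, hcs]; norm_num

end Half

end SpinMUS

/-! ### The main theorem -/

theorem mainTheorem1 :
    (∀ N : ℕ,
      -- the axes x, y, z
      (∀ ρ : SpinMUS.Op N, SpinMUS.IsState ρ →
        (SpinMUS.DiagClass ρ ∨ SpinMUS.SqueezedClass ρ →
          SpinMUS.Saturates ρ (SpinMUS.Jx N) (SpinMUS.Jy N) (SpinMUS.Jz N)) ∧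
        (SpinMUS.Saturates ρ (SpinMUS.Jx N) (SpinMUS.Jy N) (SpinMUS.Jz N) →
          SpinMUS.U ρ (SpinMUS.Jx N) * SpinMUS.U ρ (SpinMUS.Jy N) ≠ 0 →
          SpinMUS.DiagClass ρ ∨ SpinMUS.SqueezedClass ρ)) ∧
      -- general directions
      (∀ n : Fin 3 → EuclideanSpace ℝ (Fin 3), Orthonormal ℝ n →
        (∃ R : SpinMUS.Op N, SpinMUS.IsRotation R ∧
          R * SpinMUS.Jx N * Rᴴ = SpinMUS.J N (n 0) ∧
          R * SpinMUS.Jy N * Rᴴ = SpinMUS.J N (n 1) ∧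
          SpinMUS.EqUpToSign (R * SpinMUS.Jz N * Rᴴ) (SpinMUS.J N (n 2))) ∧
        ∀ ρ : SpinMUS.Op N, SpinMUS.IsState ρ →
          1 / 4 * ‖(ρ * SpinMUS.J N (n 2)).trace‖ ^ 2 ≤
            SpinMUS.U ρ (SpinMUS.J N (n 0)) * SpinMUS.U ρ (SpinMUS.J N (n 1)) ∧
          (SpinMUS.RotDiagClass n ρ ∨ SpinMUS.RotSqueezedClass n ρ →
            SpinMUS.Saturates ρ (SpinMUS.J N (n 0)) (SpinMUS.J N (n 1)) (SpinMUS.J N (n 2))) ∧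
          (SpinMUS.Saturates ρ (SpinMUS.J N (n 0)) (SpinMUS.J N (n 1)) (SpinMUS.J N (n 2)) →
            SpinMUS.U ρ (SpinMUS.J N (n 0)) * SpinMUS.U ρ (SpinMUS.J N (n 1)) ≠ 0 →
            SpinMUS.RotDiagClass n ρ ∨ SpinMUS.RotSqueezedClass n ρ) ∧
          -- the excluded case, in which both sides of the inequality vanish
          (SpinMUS.U ρ (SpinMUS.J N (n 0)) * SpinMUS.U ρ (SpinMUS.J N (n 1)) = 0 ↔
            Commute ρ (SpinMUS.J N (n 0)) ∨ Commute ρ (SpinMUS.J N (n 1))) ∧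
          (SpinMUS.U ρ (SpinMUS.J N (n 0)) * SpinMUS.U ρ (SpinMUS.J N (n 1)) = 0 →
            (ρ * SpinMUS.J N (n 2)).trace = 0)) ∧
      -- every rotation operator occurs
      (∀ R : SpinMUS.Op N, SpinMUS.IsRotation R →
        ∃ n : Fin 3 → EuclideanSpace ℝ (Fin 3), Orthonormal ℝ n ∧
          R * SpinMUS.Jx N * Rᴴ = SpinMUS.J N (n 0) ∧
          R * SpinMUS.Jy N * Rᴴ = SpinMUS.J N (n 1) ∧
          R * SpinMUS.Jz N * Rᴴ = SpinMUS.J N (n 2) ∧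
          (∀ s : ℝ, s ^ 2 ≠ 1 →
            SpinMUS.IsState (R * SpinMUS.diagState N s * Rᴴ) ∧
            SpinMUS.Saturates (R * SpinMUS.diagState N s * Rᴴ)
              (SpinMUS.J N (n 0)) (SpinMUS.J N (n 1)) (SpinMUS.J N (n 2))) ∧
          (∀ (β : ℝ) (i : Fin (N + 1)),
            SpinMUS.IsState (SpinMUS.ketbra (R *ᵥ SpinMUS.squeezed N β i)) ∧
            SpinMUS.Saturates (SpinMUS.ketbra (R *ᵥ SpinMUS.squeezed N β i))
              (SpinMUS.J N (n 0)) (SpinMUS.J N (n 1)) (SpinMUS.J N (n 2)))) ∧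
      -- Gibbs form of the diagonal states
      (∀ s : ℝ, s ≠ 0 → s ^ 2 ≠ 1 →
        SpinMUS.diagState N s = SpinMUS.gibbs N (2 * Real.log |s|)) ∧
      (∀ β : ℝ, SpinMUS.IsState (SpinMUS.gibbs N β) ∧
        SpinMUS.Saturates (SpinMUS.gibbs N β) (SpinMUS.Jx N) (SpinMUS.Jy N) (SpinMUS.Jz N)) ∧
      -- the coherent states |j,j⟩ and |j,-j⟩
      SpinMUS.diagState N 0 = SpinMUS.ketbra (SpinMUS.dicke N (Fin.last N)) ∧
      (∃ R : SpinMUS.Op N, SpinMUS.IsRotation R ∧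
        R * SpinMUS.diagState N 0 * Rᴴ = SpinMUS.ketbra (SpinMUS.dicke N 0))) ∧
    -- spin 1/2
    (∀ ρ : SpinMUS.Op 1, SpinMUS.IsState ρ →
      (SpinMUS.HalfDiagClass ρ ∨ SpinMUS.HalfPureClass ρ →
        SpinMUS.Saturates ρ (SpinMUS.Jx 1) (SpinMUS.Jy 1) (SpinMUS.Jz 1)) ∧
      (SpinMUS.Saturates ρ (SpinMUS.Jx 1) (SpinMUS.Jy 1) (SpinMUS.Jz 1) →
        SpinMUS.U ρ (SpinMUS.Jx 1) * SpinMUS.U ρ (SpinMUS.Jy 1) ≠ 0 →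
        SpinMUS.HalfDiagClass ρ ∨ SpinMUS.HalfPureClass ρ)) := by
  refine ⟨fun N => ⟨fun ρ hρ => ⟨SpinMUS.saturates_of_class, SpinMUS.class_of_saturates hρ⟩,
    fun n hn => ?_, fun R hR => ?_, fun s hs hs1 => ?_, fun β => ?_, SpinMUS.diagState_zero, ?_⟩,
    fun ρ hρ => ⟨SpinMUS.half_saturates hρ, SpinMUS.half_class_of_saturates hρ⟩⟩
  · obtain ⟨R, hR, hx, hy, hz⟩ := SpinMUS.exists_rotation_of_orthonormal (N := N) hn
    refine ⟨⟨R, hR, hx, hy, hz⟩, fun ρ hρ => ?_⟩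
    have hS := SpinMUS.setting_frame hρ n
    -- The commutator produces the cross product of `n 0` and `n 1`, which agrees with `n 2` only up
    -- to sign.
    have hZ : ‖(ρ * SpinMUS.J N (n 2)).trace‖ = ‖(ρ * SpinMUS.ang N
        (crossProduct (n 0).ofLp (n 1).ofLp)).trace‖ := by
      rw [← hz.norm_trace_eq, SpinMUS.conj_Jz hR.conjTranspose_mul hx hy]
    refine ⟨by rw [hZ]; exact hS.le_U_mul_U, SpinMUS.saturates_of_rotClass,
      SpinMUS.rotClass_of_saturates hρ hn hR hx hy hz, ?_, fun h0 => ?_⟩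
    · rw [mul_eq_zero, hS.U_eq_zero_iff, hS.swap.U_eq_zero_iff]
    · rw [← norm_eq_zero, hZ, hS.trace_eq_zero h0, norm_zero]
  · obtain ⟨n, hn, hx, hy, hz⟩ := hR.exists_frame
    have hR' := hR.conjTranspose_mul
    refine ⟨n, hn, hx, hy, hz, fun s hs => ⟨(SpinMUS.diagState_isState hs).conj hR', ?_⟩,
      fun β i => ?_⟩
    · rw [← hx, ← hy, ← hz, SpinMUS.saturates_conj hR' (SpinMUS.diagState_isState hs).1]
      exact SpinMUS.diagState_saturates hs
    · have hst := SpinMUS.ketbra_isState (SpinMUS.squeezed_unit β i)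
      rw [← SpinMUS.mul_ketbra, ← hx, ← hy, ← hz, SpinMUS.saturates_conj hR' hst.1]
      exact ⟨hst.conj hR', SpinMUS.squeezed_saturates β i⟩
  · rw [SpinMUS.diagState_eq_geo hs1, SpinMUS.gibbs_eq_geo, mul_div_cancel_left₀ _ two_ne_zero,
      Real.exp_log (abs_pos.2 hs), SpinMUS.geo_abs]
  · rw [SpinMUS.gibbs_eq_geo]
    exact ⟨SpinMUS.geo_isState N _, SpinMUS.geo_saturates N _⟩
  · obtain ⟨F, hF, -, -, hz⟩ := SpinMUS.exists_flip N
    exact ⟨F, hF, by rw [SpinMUS.diagState_zero, SpinMUS.flip_ketbra hF.conjTranspose_mul hz]⟩
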